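/- Let $k\ge 2$, let $n\ge 2k$ be even, $n=2m$. Let $\mathfrak g=\mathfrak{so}(n+k,k)$ be the Lie algebra of the scalar product on $\mathbb R^{n+2k}$ with Gram matrix $\begin{pmatrix}0&0&1_k\\0&1_n&0\\1_k&0&0\end{pmatrix}$, let $\mathfrak p\subset\mathfrak g$ be the stabilizer of the maximal isotropic subspace $L=\langle e_1,\dots,e_k\rangle$, and let $\mathfrak g=\mathfrak g_{-2}\oplus\dots\oplus\mathfrak g_2$ be the associated grading, with $\mathfrak g_0=\mathfrak{gl}(k,\mathbb R)\oplus\mathfrak{so}(n)$, $\mathfrak p_+=\mathfrak g_1\oplus\mathfrak g_2$ and $\mathfrak g_-=\mathfrak g_{-2}\oplus\mathfrak g_{-1}$. Let $\mathrm G$ be the 4:1 cover of the identity component of $\mathrm{SO}(n+k,k)$ considered for this geometry, and $\mathrm P\subset \mathrm G$ the connected parabolic subgroup with Lie algebra $\mathfrak p$; its irreducible finite-dimensional complex modules are the irreducible finite-dimensional complex representations of $\mathfrak p$. Weights are written $(\lambda_1,\dots,\lambda_k\,|\,\sigma_1,\dots,\sigma_m)$, with $\lambda$ a weight of $\mathfrak{gl}(k)$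 and $\sigma$ a weight of $\mathfrak{so}(n)$. For $\lambda\in\mathbb R^k$ let $\mathrm V_\lambda\otimes\mathbb S_\pm$ denote the irreducible $\mathrm P$-module with highest weight $(\lambda\,|\,\frac12,\dots,\frac12,\pm\frac12)$, and for $1\le i<j\le k$ let $\lambda_{(ij)}$ be $\lambda$ with $1$ added to its $i$-th and $j$-th entries. The Weyl group of $\mathfrak g\otimes\mathbb C$ acts on $\mathbb R^{k+m}$ by signed permutations with an even number of minus signs; its affine action is $\mu\mapsto w(\mu+\delta)-\delta$ with $\delta=(k+m-1,\dots,m\,|\,m-1,\dots,1,0)$. For a $\mathrm P$-module $(\mathrm W,\rho)$, the curved Casimir operator acts on (local) sections of $\mathrm G\times_{\mathrm P}\mathrm W$, i.e. on smooth $\mathrm P$-equivariant $\mathrm W$-valued functions $f$, by $\mathcal C f=\sum_{a,b}K^{ab}\,x_a.(x_b.f)$. Here $(x_a)$ is a basis of $\mathfrak g$, acting by left-invariant vector fields, and $(K^{ab})$ is the inverse of the matrix $(B(x_a,x_b))$ of the Killing form $B$. Its zero-order part is $c^{\mathfrak g_0}=\sum_r\rho(A^r)\rho(A_r)-\sum_i\rho([Z_i,X_i])$,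 for $B$-dual bases $(A^r),(A_r)$ of $\mathfrak g_0$ and $(Z_i),(X_i)$ of $\mathfrak p_+,\mathfrak g_-$. A number $c$ is called the Casimir eigenvalue of $\mathrm W$ if $c^{\mathfrak g_0}=c\cdot\mathrm{Id}_{\mathrm W}$ and $\mathcal Cf=c\,f$ for all local sections $f$. Theorem. Let $\mathrm V_\lambda\otimes\mathbb S_\pm$ and $\mathrm V_\nu\otimes\mathbb S_\pm$ be irreducible $\mathrm P$-modules such that the highest weight of the dual of each of them lies either on the affine Weyl orbit of $\frac12(1-n,\dots,1-n\,|\,1,\dots,1)$ or on the affine Weyl orbit of $\frac12(1-n,\dots,1-n\,|\,1,\dots,1,-1)$, and suppose that $\nu=\lambda_{(ij)}$ for some $1\le i<j\le k$. Then each of the two modules has a unique Casimir eigenvalue, $c_\lambda$ and $c_{\lambda_{(ij)}}$ respectively, and $$\alpha_{ij}:=c_\lambda-c_{\lambda_{(ij)}}=0 .$$ -/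

import Mathlib

open Module
open scoped Matrix ContDiff

attribute [local instance] LieRing.ofAssociativeRing
attribute [local instance] Matrix.normedAddCommGroup Matrix.normedSpace

noncomputable section

namespace KDirac

/-! Throughout, `k` and `m` are natural numbers and `n = 2 * m`. Coordinates on `ℝ^(n+2k)` are
indexed by `Idx k m`: first the `k` coordinates of the isotropic subspace `L`, then the `n`
Euclidean coordinates (in two groups of `m`, so that the `a`-th coordinate plane of `ℝ^n` is
spanned by the `a`-th vectors of the two groups), then the `k` coordinates dual to `L`. -/

/-- The index set of the coordinates of `ℝ^(n+2k)`. -/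
abbrev Idx (k m : ℕ) : Type := Fin k ⊕ ((Fin m ⊕ Fin m) ⊕ Fin k)

/-- Real square matrices of size `n + 2k`. -/
abbrev Mat (k m : ℕ) : Type := Matrix (Idx k m) (Idx k m) ℝ

/-- The involution of the coordinates exchanging `L` with its dual. -/
def conj {k m : ℕ} : Idx k m → Idx k m
  | .inl i => .inr (.inr i)
  | .inr (.inl p) => .inr (.inl p)
  | .inr (.inr i) => .inl i

/-- The Gram matrix, with rows of blocks `(0, 0, 1_k)`, `(0, 1_n, 0)`, `(1_k, 0, 0)`, of a
scalar product of signature `(n + k, k)`. -/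
def form (k m : ℕ) : Mat k m := Matrix.of fun p q => if q = conj p then 1 else 0

/-- The Lie algebra `so(n+k, k)`. -/
abbrev so (k m : ℕ) : LieSubalgebra ℝ (Mat k m) := skewAdjointMatricesLieSubalgebra (form k m)

/-- The isometry group of the scalar product; its identity component is that of
`SO(n+k, k)`. -/
def isometries (k m : ℕ) : Set (Mat k m) := {g | gᵀ * form k m * g = form k m}

/-- The maximal isotropic subspace `L`, spanned by the first `k` basis vectors. -/
def isoL (k m : ℕ) : Submodule ℝ (Idx k m → ℝ) where
  carrier := {v | ∀ q, v (.inr q) = 0}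
  add_mem' := by
    intro a b ha hb q
    simp [ha q, hb q]
  zero_mem' := by
    intro q
    rfl
  smul_mem' := by
    intro c a ha q
    simp [ha q]

/-- The parabolic subalgebra `𝔭`, the stabilizer of `L` in `so(n+k, k)`. -/
def par (k m : ℕ) : LieSubalgebra ℝ (so k m) where
  carrier := {X | ∀ v ∈ isoL k m, (X : Mat k m) *ᵥ v ∈ isoL k m}
  add_mem' := by
    intro a b ha hb v hv
    simpa [Matrix.add_mulVec] using (isoL k m).add_mem (ha v hv) (hb v hv)
  zero_mem' := by
    intro v _
    simp
  smul_mem' := by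
    intro c a ha v hv
    simpa [Matrix.smul_mulVec] using (isoL k m).smul_mem c (ha v hv)
  lie_mem' := by
    intro a b ha hb v hv
    have h1 := ha _ (hb v hv)
    have h2 := hb _ (ha v hv)
    simpa [Ring.lie_def, Matrix.sub_mulVec, Matrix.mulVec_mulVec] using
      (isoL k m).sub_mem h1 h2

lemma conj_conj {k m : ℕ} (p : Idx k m) : conj (conj p) = p := by
  rcases p with i | p | i <;> rfl

/-- Entrywise description of `so(n+k, k)`. -/
lemma mem_so_iff {k m : ℕ} (X : Mat k m) :
    X ∈ so k m ↔ ∀ p q, X (conj q) p = -X (conj p) q := by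
  have h : ∀ q r : Idx k m, (q = conj r) = (conj q = r) := fun q r =>
    propext ⟨fun e => by rw [e, conj_conj], fun e => by rw [← e, conj_conj]⟩
  rw [mem_skewAdjointMatricesLieSubalgebra, mem_skewAdjointMatricesSubmodule,
    Matrix.IsSkewAdjoint, Matrix.IsAdjointPair, ← Matrix.ext_iff]
  refine forall_congr' fun p => forall_congr' fun q => ?_
  rw [Matrix.mul_apply, Matrix.mul_apply]
  simp only [form, Matrix.of_apply, Matrix.transpose_apply, Matrix.neg_apply, mul_ite, mul_one,
    mul_zero, ite_mul, one_mul, zero_mul, Finset.sum_ite_eq', Finset.mem_univ, if_true]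
  simp only [h q, Finset.sum_ite_eq, Finset.mem_univ, if_true]

/-! ### The gradation -/

/-- The eigenvalue of the grading element `diag(1_k, 0, -1_k)` on a basis vector. -/
def deg {k m : ℕ} : Idx k m → ℤ
  | .inl _ => 1
  | .inr (.inl _) => 0
  | .inr (.inr _) => -1

lemma deg_conj {k m : ℕ} (p : Idx k m) : deg (conj p) = -deg p := by
  rcases p with i | p | i <;> rfl

/-- The component of `X` in the sum of the graded pieces `𝔤_d` for the degrees `d`
satisfying `P`; the matrix entry at `(p, q)` has degree `deg p - deg q`. -/
def part {k m : ℕ} (P : ℤ → Prop) [DecidablePred P] (X : so k m) : so k m :=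
  ⟨Matrix.of fun p q => if P (deg p - deg q) then (X : Mat k m) p q else 0, by
    rw [mem_so_iff]
    intro p q
    have h := (mem_so_iff _).1 X.2 p q
    have e : -deg q - deg p = -deg p - deg q := by ring
    simp only [Matrix.of_apply, deg_conj, e]
    split_ifs
    · exact h
    · simp⟩

lemma mem_par_of {k m : ℕ} (X : so k m)
    (h : ∀ p q, deg p < deg q → (X : Mat k m) p q = 0) : X ∈ par k m := by
  intro v hv q
  rw [Matrix.mulVec, dotProduct]
  refine Finset.sum_eq_zero fun r _ => ?_
  rcases r with i | r
  · rw [h _ _ (by rcases q with q | q <;> simp [deg]), zero_mul]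
  · rw [hv r, mul_zero]

/-- The `𝔤_0`-component, as an element of `𝔭`. -/
def levi {k m : ℕ} (X : so k m) : par k m :=
  ⟨part (fun d => d = 0) X, mem_par_of _ fun p q h => by
    simp only [part, Matrix.of_apply]
    rw [if_neg (by omega)]⟩

/-- The element `E_{p,q} - E_{q*,p*}` of `so(n+k, k)`. -/
def gen {k m : ℕ} (p q : Idx k m) : so k m :=
  ⟨Matrix.of fun r s => (if r = p ∧ s = q then (1 : ℝ) else 0) -
      (if r = conj q ∧ s = conj p then (1 : ℝ) else 0), by
    have h : ∀ q r : Idx k m, (conj q = r) = (q = conj r) := fun q r =>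
      propext ⟨fun e => by rw [← e, conj_conj], fun e => by rw [e, conj_conj]⟩
    rw [mem_so_iff]
    intro r s
    simp only [Matrix.of_apply, h, conj_conj, neg_sub]
    simp only [and_comm]⟩

/-- The element `diag(E_{i,j}, 0, -E_{j,i})`, that is, `E_{i,j}` in
`gl(k, ℝ) ⊆ 𝔤_0 = gl(k, ℝ) ⊕ so(n)`. -/
def glGen {k m : ℕ} (i j : Fin k) : par k m := levi (gen (.inl i) (.inl j))

/-- The element `E_{a,b} - E_{b,a}` of `so(n) ⊆ 𝔤_0`. -/
def soGen {k m : ℕ} (a b : Fin m ⊕ Fin m) : par k m :=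
  levi (gen (.inr (.inl a)) (.inr (.inl b)))

/-! ### Modules and weights -/

/-- A complex representation of `𝔭` on `W`. The group `P` is connected and its Levi factor
covers `GL⁺(k, ℝ)` and `Spin(n)`, so the irreducible finite dimensional `P`-modules are the
irreducible finite dimensional complex representations of `𝔭`. -/
abbrev PRep (k m : ℕ) (W : Type*) [AddCommGroup W] [Module ℂ W] : Type _ :=
  par k m →ₗ⁅ℝ⁆ Module.End ℂ W

/-- Irreducibility: there are exactly two invariant complex subspaces, `0` and `W`. -/
def IsIrr {k m : ℕ} {W : Type*} [AddCommGroup W] [Module ℂ W] (ρ : PRep k m W) : Prop :=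
  Nontrivial W ∧ ∀ U : Submodule ℂ W, (∀ A, ∀ u ∈ U, ρ A u ∈ U) → U = ⊥ ∨ U = ⊤

/-- The dual (contragredient) representation. -/
def dualRep {k m : ℕ} {W : Type*} [AddCommGroup W] [Module ℂ W] (ρ : PRep k m W) :
    PRep k m (Module.Dual ℂ W) where
  toFun A := -(ρ A).dualMap
  map_add' A B := by
    ext φ w
    simp
    ring
  map_smul' r A := by
    ext φ w
    simp
  map_lie' := by
    intro A B
    ext φ w
    simp [Ring.lie_def]

/-- `w` is a highest weight vector of weight `(lam | sig)`, for the Cartan subalgebra of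
diagonal matrices in `gl(k)` and of the span of the rotations of the `m` coordinate planes in
`so(n)`, and for the positive roots `ε_i - ε_j` (`i < j`) of `gl(k)` and `ε_a ± ε_b` (`a < b`) of
`so(n)`. In the complexification of `so(n)` the plane rotation with eigenvalue `± 1` on
`e_a ± i e_{a'}` is `-i (E_{a,a'} - E_{a',a})`, and `(e_a + i e_{a'}) ∧ (e_b ± i e_{b'})` is a
root vector for `ε_a ± ε_b`. -/
structure IsHighestWeightVector {k m : ℕ} {W : Type*} [AddCommGroup W] [Module ℂ W]
    (ρ : PRep k m W) (lam : Fin k → ℝ) (sig : Fin m → ℝ) (w : W) : Prop where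
  ne_zero : w ≠ 0
  gl_weight : ∀ i, ρ (glGen i i) w = (lam i : ℂ) • w
  so_weight : ∀ a, (-Complex.I) • ρ (soGen (.inl a) (.inr a)) w = (sig a : ℂ) • w
  gl_raise : ∀ i j, i < j → ρ (glGen i j) w = 0
  so_raise_add : ∀ a b, a < b →
    ρ (soGen (.inl a) (.inl b)) w + Complex.I • ρ (soGen (.inl a) (.inr b)) w
      + Complex.I • ρ (soGen (.inr a) (.inl b)) w - ρ (soGen (.inr a) (.inr b)) w = 0
  so_raise_sub : ∀ a b, a < b →
    ρ (soGen (.inl a) (.inl b)) w - Complex.I • ρ (soGen (.inl a) (.inr b)) w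
      + Complex.I • ρ (soGen (.inr a) (.inl b)) w + ρ (soGen (.inr a) (.inr b)) w = 0

/-- `(lam | sig)` is a highest weight of the module. -/
def HasHighestWeight {k m : ℕ} {W : Type*} [AddCommGroup W] [Module ℂ W]
    (ρ : PRep k m W) (lam : Fin k → ℝ) (sig : Fin m → ℝ) : Prop :=
  ∃ w, IsHighestWeightVector ρ lam sig w

/-- The highest weight `(1/2, …, 1/2, ± 1/2)` of the half-spin module `S_±` of `so(n)`; the
sign `s` is the sign of the last entry. -/
def spinWeight (m : ℕ) (s : ℤˣ) : Fin m → ℝ :=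
  fun a => if a.val + 1 = m then ((s : ℤ) : ℝ) / 2 else 1 / 2

/-- The irreducible `P`-module on `W` is `V_lam ⊗ S_s`: it is irreducible with highest weight
`(lam | 1/2, …, 1/2, s/2)`. -/
def IsSpinorModule {k m : ℕ} {W : Type*} [AddCommGroup W] [Module ℂ W]
    (ρ : PRep k m W) (lam : Fin k → ℝ) (s : ℤˣ) : Prop :=
  IsIrr ρ ∧ HasHighestWeight ρ lam (spinWeight m s)

/-- The weight `lam_(ij)`: one is added to the entries `i` and `j` of `lam`. -/
def raise {k : ℕ} (lam : Fin k → ℝ) (i j : Fin k) : Fin k → ℝ :=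
  lam + Pi.single i 1 + Pi.single j 1

/-- Half the sum of the positive roots of `so(n+2k, ℂ)`, i.e. `(k+m-1, …, m | m-1, …, 1, 0)`. -/
def delta (k m : ℕ) : Fin k ⊕ Fin m → ℝ :=
  Sum.elim (fun i => (k : ℝ) + m - 1 - (i : ℕ)) (fun a => (m : ℝ) - 1 - (a : ℕ))

/-- The affine orbit of `μ` under the Weyl group of `so(n+2k, ℂ)` (the signed permutations of the
coordinates with an even number of signs `-1`), acting by `μ ↦ s (μ + δ) - δ`. -/
def affineOrbit {k m : ℕ} (μ : Fin k ⊕ Fin m → ℝ) : Set (Fin k ⊕ Fin m → ℝ) :=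
  {μ' | ∃ (τ : Equiv.Perm (Fin k ⊕ Fin m)) (s : Fin k ⊕ Fin m → ℤˣ), ∏ p, s p = 1 ∧
    ∀ p, μ' p + delta k m p = ((s p : ℤ) : ℝ) * (μ (τ p) + delta k m (τ p))}

/-- The weight `1/2 (1-n, …, 1-n | 1, …, 1, t)`, where `t = ± 1` and `n = 2 * m`. -/
def baseWeight (k m : ℕ) (t : ℤˣ) : Fin k ⊕ Fin m → ℝ :=
  Sum.elim (fun _ => (1 - 2 * (m : ℝ)) / 2) (spinWeight m t)

/-- The highest weight of the dual module lies on the affine orbit of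
`1/2 (1-n, …, 1-n | 1, …, 1)` or of `1/2 (1-n, …, 1-n | 1, …, 1, -1)`. -/
def DualOnOrbits {k m : ℕ} {W : Type*} [AddCommGroup W] [Module ℂ W] (ρ : PRep k m W) : Prop :=
  ∃ (mu : Fin k → ℝ) (sig : Fin m → ℝ), HasHighestWeight (dualRep ρ) mu sig ∧
    (Sum.elim mu sig ∈ affineOrbit (baseWeight k m 1) ∨
      Sum.elim mu sig ∈ affineOrbit (baseWeight k m (-1)))

/-! ### The curved Casimir operator -/

/-- The coefficients `K^{ab}` of the form dual to the Killing form, in terms of a basis `x` of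
`𝔤`: the inverse of the matrix `B (x_a, x_b)`. -/
def killingInv {k m d : ℕ} (x : Basis (Fin d) ℝ (so k m)) : Matrix (Fin d) (Fin d) ℝ :=
  (Matrix.of fun a b => killingForm ℝ (so k m) (x a) (x b))⁻¹

/-- The zero order part `c^{𝔤_0}` of the curved Casimir operator on the bundle induced by `W`.
As `∑ K^{ab} x_a ⊗ x_b = ∑ Z_i ⊗ X_i + ∑ X_i ⊗ Z_i + ∑ A^r ⊗ A_r` for Killing-dual bases `Z_i`,
`X_i` of `𝔭_+`, `𝔤_-` and `A^r`, `A_r` of `𝔤_0`, it is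
`∑ ρ(A^r) ρ(A_r) - ρ(∑ [Z_i, X_i])`. -/
def algCasimir {k m d : ℕ} {W : Type*} [AddCommGroup W] [Module ℂ W]
    (x : Basis (Fin d) ℝ (so k m)) (ρ : PRep k m W) : Module.End ℂ W :=
  ∑ a, ∑ b, (killingInv x a b : ℂ) • (ρ (levi (x a)) * ρ (levi (x b))
    - ρ (levi ⁅part (fun e => 0 < e) (x a), part (fun e => e < 0) (x b)⁆))

section Sections

variable {k m d : ℕ} {W : Type*} [NormedAddCommGroup W] [NormedSpace ℂ W]

/-- The fundamental derivative: `X ∈ 𝔤` acts on functions on the group as the left invariant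
vector field `g ↦ g X`. -/
def fundDeriv (X : so k m) (f : Mat k m → W) : Mat k m → W :=
  fun g => fderiv ℝ f g (g * (X : Mat k m))

/-- Sections of the homogeneous bundle induced by `W` over the image of the open part
`O ∩ isometries k m` of the group: `W`-valued smooth functions that are `𝔭`-equivariant. The
function is given together with a smooth extension to an open set `O` of matrices; nothing below
depends on the extension. -/
structure IsSection (ρ : PRep k m W) (O : Set (Mat k m)) (f : Mat k m → W) : Prop where
  isOpen : IsOpen O
  smooth : ContDiffOn ℝ ∞ f O
  equivariant : ∀ g ∈ O ∩ isometries k m, ∀ A : par k m,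
    fundDeriv (A : so k m) f g = -ρ A (f g)

/-- The curved Casimir operator: the second fundamental derivative contracted with the Killing
form. -/
def curvedCasimir (x : Basis (Fin d) ℝ (so k m)) (f : Mat k m → W) : Mat k m → W :=
  fun g => ∑ a, ∑ b, (killingInv x a b : ℂ) • fundDeriv (x a) (fundDeriv (x b) f) g

/-- `c` is the Casimir eigenvalue of the module: the algebraic action of the curved Casimir
operator on `W` is `c`, and the operator acts as `c` on all local sections of the bundle. -/
structure IsCasimirEigenvalue (ρ : PRep k m W) (c : ℂ) : Prop where
  algebraic : ∀ (d : ℕ) (x : Basis (Fin d) ℝ (so k m)), algCasimir x ρ = c • 1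
  curved : ∀ (d : ℕ) (x : Basis (Fin d) ℝ (so k m)) (O : Set (Mat k m)) (f : Mat k m → W),
    IsSection ρ O f → ∀ g ∈ O ∩ isometries k m, curvedCasimir x f g = c • f g

end Sections

end KDirac

end

namespace KDirac

/-! ### The generators of `so(n+k, k)` and the Killing form -/

section Generators

variable {k m : ℕ}

/-! The curved Casimir operator acts on the bundle of an irreducible module by a scalar depending
only on the norm of `μ + δ`, where `μ` is the highest weight of the dual module. Signed permutations
are isometries, so this scalar is constant on each affine Weyl orbit. The two base weights differ
only in the sign of the last coordinate, where `δ` vanishes, so both orbits give the same value.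
Hence the difference of the two eigenvalues is zero; the relation between the weights `lam` and `nu`
plays no role in the computation.

To get the scalar, the Killing form is inverted without choosing a basis: the elements `gen p q`
form an overcomplete system, the Killing form is a multiple of the trace form (`killingForm_eq`),
and its inverse tensor is `kap` times the sum of `gen p q ⊗ gen q p` (`sum_killingInv_smul`). Every
Casimir expression thus becomes an explicit double sum over coordinates.

On an irreducible module the nilradical acts by zero (`IsIrr.rep_eq_zero`). Invariance of the tensor
under the Levi factor and Schur's lemma make the zero order part a scalar
(`IsIrr.exists_algCasimir_eq`). On sections, equivariance eliminates both derivatives: whenever one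
of the two factors lies in the nilradical, it is moved to the inner position, where it gives zero,
and the commutator left over is of order zero (`IsSection.curvedCasimir_eq`).

The scalar is evaluated by composing a highest weight vector of the dual with the operator, which
gives `2 * kap * (|μ + δ|² - |δ|²)` (`IsHighestWeightVector.sum_dualTerm`,
`smul_eq_of_dual_highestWeight`). -/

lemma conj_eq_iff (p q : Idx k m) : conj p = q ↔ p = conj q :=
  ⟨fun e => by rw [← e, conj_conj], fun e => by rw [e, conj_conj]⟩

/-- The involution `conj` as a permutation. -/
def conjEquiv (k m : ℕ) : Equiv.Perm (Idx k m) := ⟨conj, conj, conj_conj, conj_conj⟩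

lemma sum_conj {V : Type*} [AddCommMonoid V] (f : Idx k m → V) :
    ∑ p, f (conj p) = ∑ p, f p :=
  Equiv.sum_comp (conjEquiv k m) f

lemma so_apply_conj (X : so k m) (p q : Idx k m) :
    (X : Mat k m) (conj q) p = -(X : Mat k m) (conj p) q := (mem_so_iff _).1 X.2 p q

lemma so_apply_conj_conj (X : so k m) (p q : Idx k m) :
    (X : Mat k m) (conj q) (conj p) = -(X : Mat k m) p q := by
  rw [so_apply_conj, conj_conj]

lemma gen_apply (p q r s : Idx k m) : (gen p q : Mat k m) r s =
    (if r = p ∧ s = q then (1 : ℝ) else 0) - (if r = conj q ∧ s = conj p then (1 : ℝ) else 0) :=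
  rfl

lemma lie_apply (X Y : so k m) (r s : Idx k m) : (⁅X, Y⁆ : so k m).1 r s =
    ∑ t, X.1 r t * Y.1 t s - ∑ t, Y.1 r t * X.1 t s := by
  rw [LieSubalgebra.coe_bracket, Ring.lie_def, Matrix.sub_apply, Matrix.mul_apply,
    Matrix.mul_apply]

lemma lie_gen_apply (A : so k m) (p q s t : Idx k m) : (⁅A, gen p q⁆ : so k m).1 s t =
    (if t = q then A.1 s p else 0) - (if t = conj p then A.1 s (conj q) else 0)
      - (if s = p then A.1 q t else 0) + (if s = conj q then A.1 (conj p) t else 0) := by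
  rw [lie_apply]
  simp only [gen_apply, mul_sub, sub_mul, Finset.sum_sub_distrib, ite_and, mul_ite, ite_mul,
    mul_one, one_mul, mul_zero, zero_mul, Finset.sum_ite_eq', Finset.mem_univ,
    if_true, Finset.sum_ite_irrel, Finset.sum_const_zero]
  ring

lemma so_sum_apply {ι : Type*} (s : Finset ι) (F : ι → so k m) (r t : Idx k m) :
    (∑ i ∈ s, F i : so k m).1 r t = ∑ i ∈ s, (F i).1 r t := by
  induction s using Finset.cons_induction with
  | empty => simp
  | cons a s ha ih => simp only [Finset.sum_cons, ← ih]; rfl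

lemma so_ext {X Y : so k m} (h : ∀ p q, X.1 p q = Y.1 p q) : X = Y :=
  Subtype.ext (Matrix.ext h)

/-- Up to the identification by the scalar product, `gen p q` is the image of the tensor of the
`p`-th basis vector with the `q`-th dual one, so `A` acts by the product rule. -/
lemma lie_gen (A : so k m) (p q : Idx k m) :
    ⁅A, gen p q⁆ = ∑ r, A.1 r p • gen r q - ∑ r, A.1 q r • gen p r := by
  refine so_ext fun s t => ?_
  have h : (∑ r, A.1 r p • gen r q - ∑ r, A.1 q r • gen p r : so k m).1 s t =
      ∑ r, A.1 r p * (gen r q).1 s t - ∑ r, A.1 q r * (gen p r).1 s t := by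
    rw [AddSubgroupClass.coe_sub, Matrix.sub_apply, so_sum_apply, so_sum_apply]
    rfl
  have e1 : A.1 (conj p) t = -A.1 (conj t) p := so_apply_conj A t p
  have e2 : A.1 q (conj s) = -A.1 s (conj q) := by
    have := so_apply_conj_conj A s (conj q)
    rwa [conj_conj] at this
  have hs : ∀ x y : Idx k m, (x = conj y) = (y = conj x) := fun x y =>
    propext ⟨fun e => by rw [e, conj_conj], fun e => by rw [e, conj_conj]⟩
  rw [h, lie_gen_apply]
  simp only [gen_apply, mul_sub, Finset.sum_sub_distrib, ite_and, mul_ite,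
    mul_one, mul_zero]
  simp only [hs t, hs s, Finset.sum_ite_eq', Finset.sum_ite_eq, Finset.mem_univ,
    if_true, Finset.sum_ite_irrel, Finset.sum_const_zero]
  simp only [← hs, e1, e2]
  split_ifs <;> ring

/-- The factor 2 is due to the overcounting: `(p, q)` and `(conj q, conj p)` give opposite
generators and opposite entries of `X`. -/
lemma sum_smul_gen (X : so k m) : ∑ p, ∑ q, X.1 p q • gen p q = (2 : ℝ) • X := by
  refine so_ext fun s t => ?_
  have h : (∑ p, ∑ q, X.1 p q • gen p q : so k m).1 s t =
      ∑ p, ∑ q, X.1 p q * (gen p q).1 s t := by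
    simp only [so_sum_apply]
    rfl
  have h2 : ((2 : ℝ) • X).1 s t = 2 * X.1 s t := rfl
  rw [h, h2]
  simp only [gen_apply, mul_sub, Finset.sum_sub_distrib, ite_and, mul_ite, mul_one, mul_zero]
  have hs : ∀ x y : Idx k m, (x = conj y) = (conj x = y) := fun x y =>
    propext (conj_eq_iff x y).symm
  simp only [hs s, hs t, Finset.sum_ite_eq, Finset.mem_univ,
    if_true, Finset.sum_ite_irrel, Finset.sum_const_zero]
  rw [so_apply_conj_conj]
  ring

/-- The `(p, q)` entry as a linear form on `so(n+k, k)`. -/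
def entry (p q : Idx k m) : so k m →ₗ[ℝ] ℝ where
  toFun X := X.1 p q
  map_add' _ _ := rfl
  map_smul' _ _ := rfl

lemma trace_eq_sum_gen (T : so k m →ₗ[ℝ] so k m) :
    LinearMap.trace ℝ (so k m) T = (1 / 2) * ∑ p, ∑ q, (T (gen p q)).1 p q := by
  -- Half the expansion in generators writes `T` as a sum of rank one operators, whose traces are
  -- entries.
  have h : T = (1 / 2 : ℝ) • ∑ p, ∑ q, (entry p q).smulRight (T (gen p q)) := by
    ext1 X
    have := congrArg T (sum_smul_gen X)
    simp only [map_sum, map_smul] at this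
    simp only [LinearMap.smul_apply, LinearMap.sum_apply, LinearMap.smulRight_apply]
    change _ = (1 / 2 : ℝ) • ∑ p, ∑ q, X.1 p q • T (gen p q)
    rw [this, smul_smul]
    norm_num
  conv_lhs => rw [h]
  simp only [map_smul, map_sum, LinearMap.trace_smulRight, smul_eq_mul]
  rfl

/-- The trace form `tr (X Y)`. -/
def trForm (X Y : so k m) : ℝ := ∑ p, ∑ q, X.1 p q * Y.1 q p

lemma sum_diag (X : so k m) : ∑ p, X.1 p p = 0 := by
  have h := sum_conj fun p => X.1 p p
  simp only [so_apply_conj_conj, Finset.sum_neg_distrib] at h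
  linarith

lemma killingForm_eq (X Y : so k m) :
    killingForm ℝ (so k m) X Y = (2 * (m : ℝ) + 2 * k - 2) * trForm X Y := by
  rw [killingForm_apply_apply, trace_eq_sum_gen]
  have key : ∀ p q, ((LieAlgebra.ad ℝ (so k m) X ∘ₗ LieAlgebra.ad ℝ (so k m) Y) (gen p q)).1 p q
      = ∑ r, (Y.1 r p * (X.1 p r - (if q = conj r then X.1 p (conj q) else 0)
          - (if p = r then X.1 q q else 0) + (if p = conj q then X.1 (conj r) q else 0)))
        - ∑ r, (Y.1 q r * ((if q = r then X.1 p p else 0) -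
          (if q = conj p then X.1 p (conj r) else 0) - X.1 r q
          + (if p = conj r then X.1 (conj p) q else 0))) := by
    intro p q
    rw [LinearMap.comp_apply, LieAlgebra.ad_apply, LieAlgebra.ad_apply, lie_gen]
    simp only [lie_sub, lie_sum, lie_smul]
    rw [AddSubgroupClass.coe_sub, Matrix.sub_apply, so_sum_apply, so_sum_apply]
    congr 1 <;> refine Finset.sum_congr rfl fun r _ => ?_
    · change Y.1 r p * (⁅X, gen r q⁆ : so k m).1 p q = _
      rw [lie_gen_apply, if_pos rfl]
    · change Y.1 q r * (⁅X, gen p r⁆ : so k m).1 p q = _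
      rw [lie_gen_apply, if_pos (rfl : p = p)]
  simp only [key, mul_add, mul_sub, Finset.sum_add_distrib, Finset.sum_sub_distrib, mul_ite,
    mul_zero]
  have hN : (Fintype.card (Idx k m) : ℝ) = 2 * m + 2 * k := by
    simp [Idx]; ring
  have a1 : ∑ p, ∑ _q : Idx k m, ∑ r, Y.1 r p * X.1 p r = (2 * m + 2 * k) * trForm X Y := by
    simp only [Finset.sum_const, Finset.card_univ, nsmul_eq_mul, ← Finset.mul_sum, hN, trForm]
    simp only [mul_comm]
  have a2 : ∑ p, ∑ q : Idx k m, ∑ r, (if q = conj r then Y.1 r p * X.1 p (conj q) else 0)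
      = trForm X Y := by
    simp only [← conj_eq_iff, Finset.sum_ite_eq, Finset.mem_univ, if_true]
    refine Finset.sum_congr rfl fun p _ => ?_
    rw [sum_conj fun q => Y.1 q p * X.1 p q]
    simp only [mul_comm]
  have a3 : ∑ p, ∑ q : Idx k m, ∑ r, (if p = r then Y.1 r p * X.1 q q else 0) = 0 := by
    simp only [Finset.sum_ite_eq, Finset.mem_univ, if_true, ← Finset.mul_sum, sum_diag, mul_zero,
      Finset.sum_const_zero]
  have a4 : ∑ p, ∑ q : Idx k m, ∑ r, (if p = conj q then Y.1 r p * X.1 (conj r) q else 0)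
      = -trForm X Y := by
    simp only [← conj_eq_iff, Finset.sum_ite_irrel, Finset.sum_const_zero, Finset.sum_ite_eq,
      Finset.mem_univ, if_true, so_apply_conj_conj, trForm, mul_neg, Finset.sum_neg_distrib]
    simp only [mul_comm]
  have b1 : ∑ p, ∑ q : Idx k m, ∑ r, (if q = r then Y.1 q r * X.1 p p else 0) = 0 := by
    rw [Finset.sum_comm]
    simp only [Finset.sum_ite_eq, Finset.mem_univ, if_true, ← Finset.mul_sum, sum_diag, mul_zero,
      Finset.sum_const_zero]
  have b2 : ∑ p, ∑ q : Idx k m, ∑ r, (if q = conj p then Y.1 q r * X.1 p (conj r) else 0)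
      = -trForm X Y := by
    have : ∀ p r : Idx k m, Y.1 (conj p) r * X.1 p (conj r) = -(Y.1 (conj r) p * X.1 p (conj r)) :=
      fun p r => by rw [so_apply_conj Y r p]; ring
    simp only [Finset.sum_ite_irrel, Finset.sum_const_zero, Finset.sum_ite_eq',
      Finset.mem_univ, if_true, this, Finset.sum_neg_distrib, trForm]
    congr 1
    refine Finset.sum_congr rfl fun p _ => ?_
    rw [sum_conj fun q => Y.1 q p * X.1 p q]
    simp only [mul_comm]
  have b3 : ∑ _p : Idx k m, ∑ q : Idx k m, ∑ r, Y.1 q r * X.1 r q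
      = (2 * m + 2 * k) * trForm X Y := by
    rw [Finset.sum_const, Finset.card_univ, nsmul_eq_mul, hN, trForm, Finset.sum_comm]
    simp only [mul_comm]
  have b4 : ∑ p, ∑ q : Idx k m, ∑ r, (if p = conj r then Y.1 q r * X.1 (conj p) q else 0)
      = trForm X Y := by
    simp only [← conj_eq_iff, Finset.sum_ite_eq, Finset.mem_univ, if_true]
    rw [sum_conj fun p => ∑ q, Y.1 q p * X.1 p q]
    simp only [mul_comm, trForm]
  -- With `N = 2m + 2k`, two of the eight sums equal `N` times the trace form, two vanish, and the
  -- other four each contribute minus it. Half of `2N - 4` is `N - 2`.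
  rw [a1, a2, a3, a4, b1, b2, b3, b4]
  ring

/-- Up to the factor 2, `gen q p` represents the entry at `(p, q)`; this makes the family `gen q p`
dual to the family `gen p q`. -/
lemma trForm_gen (p q : Idx k m) (X : so k m) : trForm (gen q p) X = 2 * X.1 p q := by
  have hs : ∀ x y : Idx k m, (x = conj y) = (conj x = y) := fun x y =>
    propext (conj_eq_iff x y).symm
  simp only [trForm, gen_apply, sub_mul, Finset.sum_sub_distrib, ite_and, ite_mul, one_mul,
    zero_mul, Finset.sum_ite_eq', Finset.mem_univ,
    if_true, Finset.sum_ite_irrel, Finset.sum_const_zero]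
  rw [so_apply_conj_conj]
  ring

lemma trForm_sum_left {ι : Type*} (s : Finset ι) (c : ι → ℝ) (x : ι → so k m) (Y : so k m) :
    trForm (∑ b ∈ s, c b • x b) Y = ∑ b ∈ s, c b * trForm (x b) Y := by
  have : ∀ r t, (∑ b ∈ s, c b • x b : so k m).1 r t = ∑ b ∈ s, c b * (x b).1 r t := by
    intro r t
    rw [so_sum_apply]
    rfl
  simp only [trForm, this, Finset.sum_mul, Finset.mul_sum]
  calc _ = ∑ p, ∑ b ∈ s, ∑ q, c b * (x b).1 p q * Y.1 q p :=
        Finset.sum_congr rfl fun p _ => Finset.sum_comm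
    _ = _ := by
        rw [Finset.sum_comm]
        simp only [mul_assoc]

/-- The factor relating the Casimir tensor to the generators. -/
noncomputable def kap (k m : ℕ) : ℝ := (4 * (2 * (m : ℝ) + 2 * k - 2))⁻¹

/-- The sum of `gen p q ⊗ gen q p` is 4 times the inverse of the trace form: one factor 2 comes from
`trForm_gen`, the other from the overcounting in `sum_smul_gen`. This is the 4 in `kap`. -/
lemma sum_gen_repr {d : ℕ} (x : Basis (Fin d) ℝ (so k m)) (a c : Fin d) :
    ∑ b, (∑ p, ∑ q, x.repr (gen p q) a * x.repr (gen q p) b) * trForm (x b) (x c)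
      = if a = c then 4 else 0 := by
  have h1 : ∀ Y : so k m, ∑ b, x.repr Y b * trForm (x b) (x c) = trForm Y (x c) := by
    intro Y
    rw [← trForm_sum_left, x.sum_repr]
  have h2 := congrArg (fun Y => x.repr Y a) (sum_smul_gen (x c))
  simp only [map_sum, map_smul, Finsupp.coe_finsetSum, Finset.sum_apply, Finsupp.smul_apply,
    smul_eq_mul, Basis.repr_self] at h2
  calc _ = ∑ p, ∑ q, x.repr (gen p q) a * ∑ b, x.repr (gen q p) b * trForm (x b) (x c) := by
        simp only [Finset.sum_mul, Finset.mul_sum]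
        rw [Finset.sum_comm]
        refine Finset.sum_congr rfl fun p _ => ?_
        rw [Finset.sum_comm]
        refine Finset.sum_congr rfl fun q _ => Finset.sum_congr rfl fun b _ => by ring
    _ = 2 * ∑ p, ∑ q, (x c).1 p q * x.repr (gen p q) a := by
        simp only [h1, trForm_gen, Finset.mul_sum]
        refine Finset.sum_congr rfl fun p _ => Finset.sum_congr rfl fun q _ => by ring
    _ = _ := by
        rw [h2, Finsupp.single_apply]
        simp only [eq_comm (a := a)]
        split_ifs <;> norm_num

lemma killingInv_eq (h : 2 * (m : ℝ) + 2 * k - 2 ≠ 0) {d : ℕ} (x : Basis (Fin d) ℝ (so k m))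
    (a b : Fin d) :
    killingInv x a b = kap k m * ∑ p, ∑ q, x.repr (gen p q) a * x.repr (gen q p) b := by
  have : killingInv x = Matrix.of fun a b =>
      kap k m * ∑ p, ∑ q, x.repr (gen p q) a * x.repr (gen q p) b := by
    refine Matrix.inv_eq_left_inv (Matrix.ext fun a c => ?_)
    simp only [Matrix.mul_apply, Matrix.of_apply, killingForm_eq]
    have e := sum_gen_repr x a c
    calc _ = kap k m * (2 * (m : ℝ) + 2 * k - 2) *
        ∑ b, (∑ p, ∑ q, x.repr (gen p q) a * x.repr (gen q p) b) * trForm (x b) (x c) := by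
          rw [Finset.mul_sum]
          exact Finset.sum_congr rfl fun b _ => by ring
      _ = _ := by
          rw [e, Matrix.one_apply, kap]
          split_ifs
          · rw [mul_assoc, mul_comm _ (4 : ℝ), inv_mul_cancel₀ (mul_ne_zero four_ne_zero h)]
          · simp
  rw [this, Matrix.of_apply]

/-- Contraction of a bilinear map with the inverse of the Killing form. -/
lemma sum_killingInv_smul {V : Type*} [AddCommGroup V] [Module ℂ V]
    (h : 2 * (m : ℝ) + 2 * k - 2 ≠ 0) {d : ℕ} (x : Basis (Fin d) ℝ (so k m))
    (F : so k m →ₗ[ℝ] so k m →ₗ[ℝ] V) :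
    ∑ a, ∑ b, (killingInv x a b : ℂ) • F (x a) (x b)
      = kap k m • ∑ p, ∑ q, F (gen p q) (gen q p) := by
  have e : ∀ X Y : so k m, F X Y = ∑ a, ∑ b, (x.repr X a * x.repr Y b) • F (x a) (x b) := by
    intro X Y
    conv_lhs => rw [← x.sum_repr X, ← x.sum_repr Y]
    simp only [map_sum, map_smul, LinearMap.sum_apply, LinearMap.smul_apply, smul_smul,
      Finset.smul_sum]
    rw [Finset.sum_comm]
    exact Finset.sum_congr rfl fun a _ => Finset.sum_congr rfl fun b _ => by rw [mul_comm]
  simp only [Complex.coe_smul, killingInv_eq h]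
  simp only [e (gen _ _), Finset.smul_sum, Finset.mul_sum, Finset.sum_smul, smul_smul]
  calc _ = ∑ a, ∑ p, ∑ q, ∑ b, (kap k m * (x.repr (gen p q) a * x.repr (gen q p) b)) •
        F (x a) (x b) := by
        refine Finset.sum_congr rfl fun a _ => ?_
        rw [Finset.sum_comm]
        exact Finset.sum_congr rfl fun p _ => Finset.sum_comm
    _ = _ := by
        rw [Finset.sum_comm]
        exact Finset.sum_congr rfl fun p _ => Finset.sum_comm

end Generators

end KDirac

namespace KDirac

/-! ### The gradation and modules -/

section Gradation

variable {k m : ℕ}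

lemma part_apply (P : ℤ → Prop) [DecidablePred P] (X : so k m) (p q : Idx k m) :
    (part P X).1 p q = if P (deg p - deg q) then X.1 p q else 0 := rfl

lemma levi_coe (X : so k m) : (levi X : so k m) = part (fun d => d = 0) X := rfl

lemma par_ext {X Y : par k m} (h : ∀ p q, X.1.1 p q = Y.1.1 p q) : X = Y :=
  Subtype.ext (so_ext h)

/-- Stabilizing the isotropic subspace kills the entries leading out of it; skewness transports this
to the remaining block, of row degree -1 and column degree 0. -/
lemma par_apply (A : par k m) {p q : Idx k m} (h : deg p < deg q) : A.1.1 p q = 0 := by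
  have key : ∀ i r, A.1.1 (.inr r) (.inl i) = 0 := by
    intro i r
    have hv : (Pi.single (.inl i) 1 : Idx k m → ℝ) ∈ isoL k m := fun q => by simp
    have := A.2 _ hv r
    rwa [Matrix.mulVec_single_one] at this
  rcases p with i | p | i <;> rcases q with j | q | j <;> simp only [deg] at h <;> try omega
  · exact key _ _
  · exact key _ _
  · have := so_apply_conj_conj A.1 (.inr (.inr i)) (.inr (.inl q))
    rw [show (conj (.inr (.inl q)) : Idx k m) = .inr (.inl q) from rfl,
      show (conj (.inr (.inr i)) : Idx k m) = .inl i from rfl, key] at this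
    linarith

lemma part_add (P : ℤ → Prop) [DecidablePred P] (X Y : so k m) :
    part P (X + Y) = part P X + part P Y :=
  so_ext fun p q => by
    change _ = (part P X).1 p q + (part P Y).1 p q
    simp only [part_apply]
    split_ifs
    · rfl
    · simp

lemma part_smul (P : ℤ → Prop) [DecidablePred P] (c : ℝ) (X : so k m) :
    part P (c • X) = c • part P X :=
  so_ext fun p q => by
    change _ = c * (part P X).1 p q
    simp only [part_apply]
    split_ifs
    · rfl
    · simp

lemma levi_add (X Y : so k m) : levi (X + Y) = levi X + levi Y :=
  Subtype.ext (part_add (fun d => d = 0) X Y)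

lemma levi_smul (c : ℝ) (X : so k m) : levi (c • X) = c • levi X :=
  Subtype.ext (part_smul (fun d => d = 0) c X)

lemma levi_zero : levi (0 : so k m) = 0 := par_ext fun p q => by
  rw [levi_coe, part_apply]
  exact ite_self _

lemma gen_apply_eq_zero {p q r s : Idx k m} (h : deg r - deg s ≠ deg p - deg q) :
    (gen p q : Mat k m) r s = 0 := by
  rw [gen_apply, if_neg, if_neg, sub_zero]
  · rintro ⟨rfl, rfl⟩
    rw [deg_conj, deg_conj] at h
    omega
  · rintro ⟨rfl, rfl⟩
    exact h rfl

lemma part_gen (P : ℤ → Prop) [DecidablePred P] (p q : Idx k m) :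
    part P (gen p q) = if P (deg p - deg q) then gen p q else 0 := by
  refine so_ext fun r s => ?_
  rw [part_apply]
  by_cases e : deg r - deg s = deg p - deg q
  · rw [e]
    split_ifs <;> rfl
  · rw [gen_apply_eq_zero e, ite_self]
    split_ifs
    · exact (gen_apply_eq_zero e).symm
    · rfl

lemma levi_gen {p q : Idx k m} (h : deg p = deg q) : (levi (gen p q) : so k m) = gen p q := by
  rw [levi_coe, part_gen, if_pos (by omega)]

lemma levi_gen_of_ne {p q : Idx k m} (h : deg p ≠ deg q) : levi (gen p q) = 0 :=
  Subtype.ext (by rw [levi_coe, part_gen, if_neg (by omega)]; rfl)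

lemma part_lie_levi (P : ℤ → Prop) [DecidablePred P] (A X : so k m) :
    part P ⁅(levi A : so k m), X⁆ = ⁅(levi A : so k m), part P X⁆ := by
  refine so_ext fun p q => ?_
  have h : ∀ x y : ℝ, (if P (deg p - deg q) then x - y else 0)
      = (if P (deg p - deg q) then x else 0) - (if P (deg p - deg q) then y else 0) :=
    fun x y => by split_ifs <;> simp
  rw [part_apply, lie_apply, lie_apply, h, Finset.ite_sum_zero, Finset.ite_sum_zero]
  simp only [levi_coe, part_apply]
  congr 1 <;> refine Finset.sum_congr rfl fun t _ => ?_
  · by_cases h : deg p - deg t = 0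
    · rw [if_pos h, show deg t = deg p by omega]
      split_ifs <;> simp
    · simp [h]
  · by_cases h : deg t - deg q = 0
    · rw [if_pos h, show deg t = deg q by omega]
      split_ifs <;> simp
    · simp [h]

lemma levi_lie_levi (A X : so k m) :
    levi ⁅(levi A : so k m), X⁆ = ⁅levi A, levi X⁆ :=
  Subtype.ext (part_lie_levi (fun d => d = 0) A X)

/-- The nilradical is an ideal of the parabolic: in each product contributing to a degree zero
entry, a strictly positive degree would have to be balanced by a negative one. -/
lemma levi_lie_eq_zero {Z : par k m} (hZ : levi (Z : so k m) = 0) (A : par k m) :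
    levi (⁅Z, A⁆ : par k m).1 = 0 := by
  have h0 : ∀ p q, ¬ deg q < deg p → Z.1.1 p q = 0 := by
    intro p q h
    rcases lt_or_eq_of_le (not_lt.1 h) with h | h
    · exact par_apply Z h
    · have : (levi (Z : so k m)).1.1 p q = 0 := by rw [hZ]; rfl
      rwa [levi_coe, part_apply, if_pos (by omega)] at this
  refine par_ext fun p q => ?_
  change (if deg p - deg q = 0 then (⁅Z.1, A.1⁆ : so k m).1 p q else 0) = 0
  split_ifs with h
  · rw [lie_apply, Finset.sum_eq_zero, Finset.sum_eq_zero, sub_zero] <;> intro t _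
    · by_cases h1 : deg q < deg t
      · rw [par_apply A (by omega), zero_mul]
      · rw [h0 _ _ (by omega), mul_zero]
    · by_cases h1 : deg t < deg p
      · rw [par_apply A (by omega), mul_zero]
      · rw [h0 _ _ (by omega), zero_mul]
  · rfl

/-- The grading element. -/
noncomputable def grad (k m : ℕ) : par k m := ∑ i, glGen i i

lemma grad_apply (p q : Idx k m) : (grad k m).1.1 p q = if p = q then (deg p : ℝ) else 0 := by
  have h : (grad k m).1 = ∑ i : Fin k, (gen (.inl i) (.inl i) : so k m) := by
    rw [grad, AddSubmonoidClass.coe_finsetSum]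
    exact Finset.sum_congr rfl fun i _ => levi_gen rfl
  rw [h, so_sum_apply]
  simp only [gen_apply, Finset.sum_sub_distrib]
  rcases p with i | p | i <;> rcases q with j | q | j <;>
    simp [deg, conj, ite_and, eq_comm, apply_ite (Neg.neg : ℝ → ℝ)]

lemma lie_grad_apply (X : so k m) (p q : Idx k m) :
    (⁅((grad k m : par k m) : so k m), X⁆ : so k m).1 p q = (deg p - deg q : ℝ) * X.1 p q := by
  rw [lie_apply]
  simp only [grad_apply, ite_mul, zero_mul, mul_ite, mul_zero, Finset.sum_ite_eq,
    Finset.sum_ite_eq', Finset.mem_univ, if_true]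
  ring

/-- The component of positive degree `d`, as an element of `𝔭`. -/
def posPart (d : ℕ) (X : so k m) : par k m :=
  ⟨part (fun e => e = d) X, mem_par_of _ fun p q h => by
    rw [part_apply, if_neg (by omega)]⟩

lemma lie_grad_posPart (d : ℕ) (X : so k m) :
    ⁅grad k m, posPart d X⁆ = (d : ℝ) • posPart d X := by
  refine par_ext fun p q => ?_
  change (⁅((grad k m : par k m) : so k m), (posPart d X).1⁆ : so k m).1 p q
    = d * (posPart d X).1.1 p q
  rw [lie_grad_apply]
  change _ * (if _ then _ else _) = _ * (if _ then _ else _)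
  split_ifs with h
  · have : (deg p - deg q : ℝ) = d := by exact_mod_cast h
    rw [this]
  · simp

lemma eq_posPart_add {Z : par k m} (hZ : levi (Z : so k m) = 0) :
    Z = posPart 1 Z.1 + posPart 2 Z.1 := by
  refine par_ext fun p q => ?_
  change _ = (part (fun e => e = (1 : ℕ)) Z.1).1 p q + (part (fun e => e = (2 : ℕ)) Z.1).1 p q
  rw [part_apply, part_apply]
  rcases lt_trichotomy (deg p) (deg q) with h | h | h
  · rw [par_apply Z h, ite_self, ite_self, add_zero]
  · have : (levi (Z : so k m)).1.1 p q = 0 := by rw [hZ]; rfl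
    rw [levi_coe, part_apply, if_pos (by omega)] at this
    rw [this, ite_self, ite_self, add_zero]
  · have : deg p - deg q = 1 ∨ deg p - deg q = 2 := by
      rcases p with i | p | i <;> rcases q with j | q | j <;> simp only [deg] at h ⊢ <;> omega
    rcases this with h | h <;> simp [h]

end Gradation

/-! ### Irreducible modules and the zero order part of the Casimir operator -/

section Modules

variable {k m : ℕ} {W : Type*} [AddCommGroup W] [Module ℂ W]

lemma rep_lie (ρ : PRep k m W) (A B : par k m) : ρ ⁅A, B⁆ = ρ A * ρ B - ρ B * ρ A := by
  rw [LieHom.map_lie, Ring.lie_def]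

lemma rep_lie_apply (ρ : PRep k m W) (A B : par k m) (w : W) :
    ρ ⁅A, B⁆ w = ρ A (ρ B w) - ρ B (ρ A w) := by
  rw [rep_lie]
  rfl

/-- The nilradical of `𝔭` acts trivially on irreducible modules. -/
lemma IsIrr.rep_eq_zero [FiniteDimensional ℂ W] {ρ : PRep k m W} (hρ : IsIrr ρ) {Z : par k m}
    (hZ : levi (Z : so k m) = 0) : ρ Z = 0 := by
  have := hρ.1
  -- The vectors killed by the nilradical form an invariant subspace, so by irreducibility it is
  -- enough to find a nonzero one.
  let U : Submodule ℂ W := ⨅ Z : {Z : par k m // levi (Z : so k m) = 0}, LinearMap.ker (ρ Z)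
  have hU : ∀ w, w ∈ U ↔ ∀ Z : par k m, levi (Z : so k m) = 0 → ρ Z w = 0 := by
    intro w
    simp [U, Submodule.mem_iInf]
  have hinv : ∀ A, ∀ u ∈ U, ρ A u ∈ U := by
    intro A u hu
    rw [hU] at hu ⊢
    intro Z hZ
    have h := rep_lie_apply ρ Z A u
    rw [hu _ (levi_lie_eq_zero hZ A), hu _ hZ, map_zero, sub_zero] at h
    exact h.symm
  have hne : U ≠ ⊥ := by
    -- An eigenvector of the grading element whose eigenvalue has maximal real part: elements of
    -- degree `d > 0` shift the eigenvalue by `d`, hence must kill it.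
    obtain ⟨c₀, hc₀⟩ := Module.End.exists_eigenvalue (ρ (grad k m))
    obtain ⟨c, hc, hmax⟩ := Set.Finite.exists_maximalFor Complex.re _
      (Module.End.finite_hasEigenvalue (ρ (grad k m))) ⟨c₀, hc₀⟩
    obtain ⟨w, hw⟩ := Module.End.HasEigenvalue.exists_hasEigenvector hc
    have hd : ∀ (d : ℕ) (_ : 0 < d) (X : so k m), ρ (posPart d X) w = 0 := by
      intro d hd X
      by_contra hne
      have h := rep_lie_apply ρ (grad k m) (posPart d X) w
      rw [lie_grad_posPart, hw.apply_eq_smul, map_smul, map_smul, LinearMap.smul_apply,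
        ← Complex.coe_smul] at h
      have h2 : (ρ (grad k m)).HasEigenvalue (c + d) := by
        refine Module.End.hasEigenvalue_of_hasEigenvector (x := ρ (posPart d X) w)
          ⟨Module.End.mem_eigenspace_iff.2 ?_, hne⟩
        rw [add_smul]
        exact sub_eq_iff_eq_add'.1 h.symm
      have h3 := hmax h2 (by simp)
      simp at h3
      omega
    intro hb
    refine hw.2 ((Submodule.eq_bot_iff U).1 hb w ((hU w).2 fun Z hZ => ?_))
    rw [eq_posPart_add hZ, map_add, LinearMap.add_apply, hd 1 one_pos, hd 2 two_pos, add_zero]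
  have htop := (hρ.2 U hinv).resolve_left hne
  ext w
  exact (hU w).1 (htop ▸ Submodule.mem_top) Z hZ

lemma IsIrr.rep_eq_rep_levi [FiniteDimensional ℂ W] {ρ : PRep k m W} (hρ : IsIrr ρ)
    (A : par k m) : ρ A = ρ (levi A.1) := by
  rw [← sub_eq_zero, ← map_sub]
  refine hρ.rep_eq_zero (par_ext fun p q => ?_)
  change (if _ then A.1.1 p q - (if _ then _ else _) else 0) = 0
  split_ifs <;> simp

/-- Schur's lemma. -/
lemma IsIrr.exists_eq_smul_one [FiniteDimensional ℂ W] {ρ : PRep k m W} (hρ : IsIrr ρ)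
    (T : Module.End ℂ W) (hT : ∀ A, Commute (ρ A) T) : ∃ c : ℂ, T = c • 1 := by
  have := hρ.1
  obtain ⟨c, hc⟩ := Module.End.exists_eigenvalue T
  refine ⟨c, ?_⟩
  have h := (hρ.2 (Module.End.eigenspace T c) fun A u hu => ?_).resolve_left hc
  · ext w
    have hw : w ∈ Module.End.eigenspace T c := h ▸ Submodule.mem_top
    simpa using Module.End.mem_eigenspace_iff.1 hw
  · rw [Module.End.mem_eigenspace_iff] at hu ⊢
    have := congrArg (fun S : Module.End ℂ W => S u) (hT A).eq
    simp only [Module.End.mul_apply] at this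
    rw [← this, hu, map_smul]

/-- The bilinear map whose contraction with the Killing form is the zero order part of the curved
Casimir operator. -/
noncomputable def casimirMap (ρ : PRep k m W) : so k m →ₗ[ℝ] so k m →ₗ[ℝ] Module.End ℂ W :=
  LinearMap.mk₂ ℝ (fun X Y => ρ (levi X) * ρ (levi Y)
    - ρ (levi ⁅part (fun e => 0 < e) X, part (fun e => e < 0) Y⁆))
    (fun X₁ X₂ Y => by
      simp only [part_add, levi_add, add_lie, map_add, add_mul]
      abel)
    (fun c X Y => by
      simp only [part_smul, levi_smul, smul_lie, map_smul, smul_mul_assoc, smul_sub])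
    (fun X Y₁ Y₂ => by
      simp only [part_add, levi_add, lie_add, map_add, mul_add]
      abel)
    (fun c X Y => by
      simp only [part_smul, levi_smul, lie_smul, map_smul, mul_smul_comm, smul_sub])

lemma casimirMap_apply (ρ : PRep k m W) (X Y : so k m) :
    casimirMap ρ X Y = ρ (levi X) * ρ (levi Y)
      - ρ (levi ⁅part (fun e => 0 < e) X, part (fun e => e < 0) Y⁆) := rfl

lemma algCasimir_eq (h : 2 * (m : ℝ) + 2 * k - 2 ≠ 0) {d : ℕ} (x : Basis (Fin d) ℝ (so k m))
    (ρ : PRep k m W) :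
    algCasimir x ρ = kap k m • ∑ p, ∑ q, casimirMap ρ (gen p q) (gen q p) :=
  sum_killingInv_smul h x (casimirMap ρ)

/-- Invariance of the Casimir tensor. -/
lemma sum_gen_invariant {V : Type*} [AddCommGroup V] [Module ℝ V]
    (F : so k m →ₗ[ℝ] so k m →ₗ[ℝ] V) (A : so k m) :
    ∑ p, ∑ q, (F ⁅A, gen p q⁆ (gen q p) + F (gen p q) ⁅A, gen q p⁆) = 0 := by
  simp only [lie_gen, map_sub, map_sum, map_smul, LinearMap.sub_apply, LinearMap.sum_apply,
    LinearMap.smul_apply, Finset.sum_add_distrib, Finset.sum_sub_distrib]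
  have h1 : ∑ p, ∑ q, ∑ r, A.1 r p • F (gen r q) (gen q p)
      = ∑ p, ∑ q, ∑ r, A.1 p r • F (gen p q) (gen q r) := by
    calc _ = ∑ q, ∑ p, ∑ r, A.1 r p • F (gen r q) (gen q p) := Finset.sum_comm
      _ = ∑ q, ∑ r, ∑ p, A.1 r p • F (gen r q) (gen q p) :=
        Finset.sum_congr rfl fun q _ => Finset.sum_comm
      _ = _ := Finset.sum_comm
  have h2 : ∑ p, ∑ q, ∑ r, A.1 q r • F (gen p r) (gen q p)
      = ∑ p, ∑ q, ∑ r, A.1 r q • F (gen p q) (gen r p) :=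
    Finset.sum_congr rfl fun p _ => Finset.sum_comm
  rw [h1, h2]
  abel

/-- Taking graded components commutes with brackets by elements of degree zero, so the Leibniz rule
applies to both terms of `casimirMap`. -/
lemma casimirMap_commutator (ρ : PRep k m W) (A X Y : so k m) :
    ρ (levi A) * casimirMap ρ X Y - casimirMap ρ X Y * ρ (levi A)
      = casimirMap ρ ⁅(levi A : so k m), X⁆ Y + casimirMap ρ X ⁅(levi A : so k m), Y⁆ := by
  simp only [casimirMap_apply, part_lie_levi, levi_lie_levi, rep_lie]
  have h : levi ⁅⁅(levi A : so k m), part (fun e => 0 < e) X⁆, part (fun e => e < 0) Y⁆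
      + levi ⁅part (fun e => 0 < e) X, ⁅(levi A : so k m), part (fun e => e < 0) Y⁆⁆
      = ⁅levi A, levi ⁅part (fun e => 0 < e) X, part (fun e => e < 0) Y⁆⁆ := by
    rw [← levi_lie_levi, ← levi_add, ← leibniz_lie]
  have h' := congrArg ρ h
  rw [map_add, rep_lie] at h'
  rw [sub_add_sub_comm, h']
  noncomm_ring

/-- The contraction commutes with the Levi factor by invariance of the tensor, and the rest of the
parabolic acts trivially; Schur's lemma then applies. -/
lemma IsIrr.exists_algCasimir_eq [FiniteDimensional ℂ W] {ρ : PRep k m W} (hρ : IsIrr ρ) :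
    ∃ c : ℂ, kap k m • ∑ p, ∑ q, casimirMap ρ (gen p q) (gen q p) = c • 1 := by
  refine hρ.exists_eq_smul_one _ fun A => ?_
  refine Commute.smul_right ?_ _
  rw [Commute, SemiconjBy, ← sub_eq_zero, hρ.rep_eq_rep_levi A]
  simp only [Finset.mul_sum, Finset.sum_mul]
  simp only [← Finset.sum_sub_distrib, casimirMap_commutator]
  exact sum_gen_invariant _ _

/-- The case distinction appears because `gen p (conj p)` is zero. The brackets are diagonal, so
weight vectors see them as scalars. -/
lemma lie_gen_gen (p q : Idx k m) :
    ⁅gen p q, gen q p⁆ = if q = conj p then (0 : so k m) else gen p p - gen q q := by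
  rw [lie_gen]
  simp only [gen_apply, sub_smul, Finset.sum_sub_distrib, ite_and, ite_smul, one_smul, zero_smul,
    Finset.sum_ite_eq', Finset.mem_univ, if_true, Finset.sum_ite_irrel, Finset.sum_const_zero]
  by_cases h : q = conj p
  · simp [h, conj_conj]
  · have h' : ¬ p = conj q := fun e => h (by rw [e, conj_conj])
    simp [h, h']

lemma casimirMap_gen_of_eq (ρ : PRep k m W)
    {p q : Idx k m} (h : deg p = deg q) :
    casimirMap ρ (gen p q) (gen q p) = ρ (levi (gen p q)) * ρ (levi (gen q p)) := by
  rw [casimirMap_apply, part_gen, if_neg (by omega), zero_lie, levi_zero, map_zero, sub_zero]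

lemma casimirMap_gen_of_lt (ρ : PRep k m W)
    {p q : Idx k m} (h : deg p < deg q) : casimirMap ρ (gen p q) (gen q p) = 0 := by
  rw [casimirMap_apply, part_gen, if_neg (by omega), zero_lie, levi_zero, map_zero, sub_zero,
    levi_gen_of_ne (by omega), map_zero, zero_mul]

lemma casimirMap_gen_of_gt (ρ : PRep k m W)
    {p q : Idx k m} (h : deg q < deg p) :
    casimirMap ρ (gen p q) (gen q p) = -ρ (levi ⁅gen p q, gen q p⁆) := by
  rw [casimirMap_apply, part_gen, if_pos (by omega), part_gen, if_pos (by omega),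
    levi_gen_of_ne (by omega), map_zero, zero_mul, zero_sub]

lemma gen_mem_par {p q : Idx k m} (h : deg q ≤ deg p) : gen p q ∈ par k m :=
  mem_par_of _ fun _ _ hrs => gen_apply_eq_zero (by omega)

/-- Equivariance reverses the order of two derivatives along the Levi factor. The reversal is
harmless in the sum, which is symmetric under exchanging `p` and `q` among pairs of equal degree. -/
lemma sum_ite_casimirMap (ρ : PRep k m W) (w : W) :
    ∑ p, ∑ q, (if deg p = deg q then casimirMap ρ (gen q p) (gen p q) w
        else casimirMap ρ (gen p q) (gen q p) w)
      = ∑ p, ∑ q, casimirMap ρ (gen p q) (gen q p) w := by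
  have h : ∀ F : Idx k m → Idx k m → W, ∑ p, ∑ q, (if deg p = deg q then F q p else F p q)
      = ∑ p, ∑ q, F p q := by
    intro F
    have e : ∀ p q, (if deg p = deg q then F q p else F p q)
        = (if deg q = deg p then F q p else 0) + (if deg p = deg q then 0 else F p q) := by
      intro p q
      by_cases h : deg p = deg q
      · simp [h]
      · simp [h, Ne.symm h]
    simp only [e, Finset.sum_add_distrib]
    rw [Finset.sum_comm, ← Finset.sum_add_distrib]
    refine Finset.sum_congr rfl fun p _ => ?_
    rw [← Finset.sum_add_distrib]
    refine Finset.sum_congr rfl fun q _ => ?_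
    split_ifs <;> simp
  exact h fun p q => casimirMap ρ (gen p q) (gen q p) w

end Modules

end KDirac

namespace KDirac

/-! ### The curved Casimir operator on sections -/

section Curves

variable {k m : ℕ}

lemma form_apply (p q : Idx k m) : form k m p q = if q = conj p then 1 else 0 := rfl

lemma form_mul_form : form k m * form k m = 1 := by
  ext p q
  rw [Matrix.mul_apply]
  simp only [form_apply, ite_mul, one_mul, zero_mul, Finset.sum_ite_eq', Finset.mem_univ, if_true,
    conj_conj, Matrix.one_apply, eq_comm]

/-- Conjugation by the Gram matrix turns the transpose of `X` into `-X`, hence the transpose of the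
exponential into its inverse. -/
lemma exp_mem_isometries (X : so k m) : NormedSpace.exp (X : Mat k m) ∈ isometries k m := by
  have h : (X : Mat k m)ᵀ * form k m = form k m * -(X : Mat k m) := by
    have := X.2
    rwa [mem_skewAdjointMatricesLieSubalgebra, mem_skewAdjointMatricesSubmodule] at this
  have hJ : (form k m)⁻¹ = form k m := Matrix.inv_eq_left_inv form_mul_form
  have hu : IsUnit (form k m) := IsUnit.of_mul_eq_one _ form_mul_form
  have e : form k m * (X : Mat k m)ᵀ * (form k m)⁻¹ = -(X : Mat k m) := by
    rw [hJ, mul_assoc, h, ← mul_assoc, form_mul_form, one_mul]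
  have e2 := Matrix.exp_conj (form k m) (X : Mat k m)ᵀ hu
  rw [e, hJ, Matrix.exp_transpose] at e2
  have e3 : (NormedSpace.exp (X : Mat k m))ᵀ * form k m
      = form k m * NormedSpace.exp (-(X : Mat k m)) := by
    rw [e2, ← mul_assoc, ← mul_assoc, form_mul_form, one_mul]
  change _ * _ * _ = _
  rw [e3, mul_assoc, ← Matrix.exp_add_of_commute _ _ (Commute.refl (X : Mat k m)).neg_left,
    neg_add_cancel, NormedSpace.exp_zero, mul_one]

lemma mul_mem_isometries {g h : Mat k m} (hg : g ∈ isometries k m) (hh : h ∈ isometries k m) :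
    g * h ∈ isometries k m := by
  change _ = _ at hg hh
  change _ = _
  calc _ = hᵀ * (gᵀ * form k m * g) * h := by
        rw [Matrix.transpose_mul]
        simp only [mul_assoc]
    _ = _ := by rw [hg, hh]

open scoped Matrix.Norms.Operator in
lemma hasDerivAt_exp_entry (X : Mat k m) (p q : Idx k m) :
    HasDerivAt (fun t : ℝ => (NormedSpace.exp (t • X) : Mat k m) p q) (X p q) 0 := by
  have h := hasDerivAt_exp_smul_const (𝕂 := ℝ) X 0
  -- The derivative of the exponential is taken for the operator norm, which makes matrices a normed
  -- algebra; the passage to entries removes the dependence on the norm.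
  rw [zero_smul, NormedSpace.exp_zero, one_mul] at h
  exact hasDerivAt_pi.1 (hasDerivAt_pi.1 h p) q

lemma hasDerivAt_mul_exp (g X : Mat k m) :
    HasDerivAt (fun t : ℝ => g * NormedSpace.exp (t • X)) (g * X) 0 := by
  refine hasDerivAt_pi.2 fun p => hasDerivAt_pi.2 fun q => ?_
  simp only [Matrix.mul_apply]
  exact HasDerivAt.fun_sum fun r _ => (hasDerivAt_exp_entry X r q).const_mul (g p r)

end Curves

/-! ### Fundamental derivatives of sections -/

section Derivatives

variable {k m : ℕ} {W : Type*} [NormedAddCommGroup W] [NormedSpace ℂ W]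

/-- Derivatives in directions tangent to the group depend only on the values on the group. -/
lemma fundDeriv_congr {u v : Mat k m → W} {O : Set (Mat k m)} (hO : IsOpen O) {g : Mat k m}
    (hg : g ∈ O ∩ isometries k m) (hu : DifferentiableAt ℝ u g) (hv : DifferentiableAt ℝ v g)
    (huv : ∀ h ∈ O ∩ isometries k m, u h = v h) (X : so k m) :
    fundDeriv X u g = fundDeriv X v g := by
  have hγ := hasDerivAt_mul_exp g (X : Mat k m)
  have h0 : g * NormedSpace.exp ((0 : ℝ) • (X : Mat k m)) = g := by
    rw [zero_smul, NormedSpace.exp_zero, mul_one]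
  have hu' : HasDerivAt (fun t : ℝ => u (g * NormedSpace.exp (t • (X : Mat k m))))
      (fderiv ℝ u g (g * X)) 0 :=
    HasFDerivAt.comp_hasDerivAt (0 : ℝ) (by rw [h0]; exact hu.hasFDerivAt) hγ
  have hv' : HasDerivAt (fun t : ℝ => v (g * NormedSpace.exp (t • (X : Mat k m))))
      (fderiv ℝ v g (g * X)) 0 :=
    HasFDerivAt.comp_hasDerivAt (0 : ℝ) (by rw [h0]; exact hv.hasFDerivAt) hγ
  refine hu'.unique (hv'.congr_of_eventuallyEq ?_)
  have hO' : ∀ᶠ t : ℝ in nhds 0, g * NormedSpace.exp (t • (X : Mat k m)) ∈ O :=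
    hγ.continuousAt.eventually_mem (by rw [h0]; exact hO.mem_nhds hg.1)
  filter_upwards [hO'] with t ht
  exact huv _ ⟨ht, mul_mem_isometries hg.2 (exp_mem_isometries (t • X))⟩

lemma two_le_infty : (1 + 1 : WithTop ℕ∞) ≤ ∞ := by
  rw [one_add_one_eq_two]
  exact WithTop.coe_le_coe.2 (le_top : (2 : ℕ∞) ≤ ⊤)

/-- Right multiplication by a matrix. -/
noncomputable def mulRightL (Y : Mat k m) : Mat k m →L[ℝ] Mat k m :=
  LinearMap.toContinuousLinearMap (LinearMap.mulRight ℝ Y)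

lemma hasFDerivAt_fundDeriv {f : Mat k m → W} {g : Mat k m} (hf : ContDiffAt ℝ ∞ f g)
    (Y : so k m) :
    ∃ T : Mat k m →L[ℝ] W, HasFDerivAt (fundDeriv Y f) T g ∧ ∀ X : Mat k m,
      T X = fderiv ℝ f g (X * Y) + fderiv ℝ (fderiv ℝ f) g X (g * Y) := by
  have h1 : HasFDerivAt (fderiv ℝ f) (fderiv ℝ (fderiv ℝ f) g) g :=
    ((hf.fderiv_right (m := 1) two_le_infty).differentiableAt
      (by simp)).hasFDerivAt
  exact ⟨_, h1.clm_apply (mulRightL (Y : Mat k m)).hasFDerivAt, fun X => rfl⟩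

lemma fundDeriv_fundDeriv {f : Mat k m → W} {g : Mat k m} (hf : ContDiffAt ℝ ∞ f g)
    (X Y : so k m) :
    fundDeriv X (fundDeriv Y f) g = fderiv ℝ f g (g * X * Y)
      + fderiv ℝ (fderiv ℝ f) g (g * X) (g * Y) := by
  obtain ⟨T, hT, h⟩ := hasFDerivAt_fundDeriv hf Y
  rw [fundDeriv, hT.fderiv, h]

lemma mul_coe_add (g : Mat k m) (X Y : so k m) :
    g * ((X + Y : so k m) : Mat k m) = g * (X : Mat k m) + g * (Y : Mat k m) := mul_add g _ _

lemma mul_coe_smul (g : Mat k m) (c : ℝ) (X : so k m) :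
    g * ((c • X : so k m) : Mat k m) = c • (g * (X : Mat k m)) := Matrix.mul_smul g c _

/-- The second derivative of `f` is symmetric and cancels; only the first order terms in directions
`g X Y` and `g Y X` survive. -/
lemma fundDeriv_comm {f : Mat k m → W} {g : Mat k m} (hf : ContDiffAt ℝ ∞ f g) (X Y : so k m) :
    fundDeriv X (fundDeriv Y f) g = fundDeriv Y (fundDeriv X f) g + fundDeriv ⁅X, Y⁆ f g := by
  have hs : IsSymmSndFDerivAt ℝ f g :=
    hf.isSymmSndFDerivAt (by
      rw [minSmoothness_of_isRCLikeNormedField, ← one_add_one_eq_two]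
      exact two_le_infty)
  have e : fderiv ℝ (fderiv ℝ f) g (g * X) (g * Y) = fderiv ℝ (fderiv ℝ f) g (g * Y) (g * X) :=
    hs.eq _ _
  have e2 : g * ((⁅X, Y⁆ : so k m) : Mat k m) = g * X * Y - g * Y * X := by
    rw [LieSubalgebra.coe_bracket, Ring.lie_def, mul_sub, ← mul_assoc, ← mul_assoc]
  rw [fundDeriv_fundDeriv hf, fundDeriv_fundDeriv hf, e, fundDeriv, e2, map_sub]
  abel

/-- The second fundamental derivative as a bilinear map. -/
noncomputable def secondDeriv {f : Mat k m → W} {g : Mat k m} (hf : ContDiffAt ℝ ∞ f g) :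
    so k m →ₗ[ℝ] so k m →ₗ[ℝ] W :=
  LinearMap.mk₂ ℝ (fun X Y => fundDeriv X (fundDeriv Y f) g)
    (fun X₁ X₂ Y => by simp only [fundDeriv, mul_coe_add, map_add])
    (fun c X Y => by simp only [fundDeriv, mul_coe_smul, map_smul])
    (fun X Y₁ Y₂ => by
      simp only [fundDeriv_fundDeriv hf, mul_coe_add, map_add]
      abel)
    (fun c X Y => by simp only [fundDeriv_fundDeriv hf, mul_coe_smul, map_smul, smul_add])

variable {ρ : PRep k m W} {O : Set (Mat k m)} {f : Mat k m → W}

lemma IsSection.contDiffAt (hf : IsSection ρ O f) {g : Mat k m} (hg : g ∈ O) :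
    ContDiffAt ℝ ∞ f g := hf.smooth.contDiffAt (hf.isOpen.mem_nhds hg)

/-- Equivariance holds only on the group, so it can be differentiated only along tangent directions,
by `fundDeriv_congr`. -/
lemma IsSection.fundDeriv_fundDeriv_par [FiniteDimensional ℂ W] (hf : IsSection ρ O f)
    {g : Mat k m} (hg : g ∈ O ∩ isometries k m) (X : so k m) (A : par k m) :
    fundDeriv X (fundDeriv (A : so k m) f) g = -ρ A (fundDeriv X f g) := by
  have hd := (hf.contDiffAt hg.1).differentiableAt (by simp)
  let T : W →L[ℝ] W := (LinearMap.toContinuousLinearMap (-ρ A)).restrictScalars ℝ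
  have hT : HasFDerivAt (fun h => T (f h)) (T.comp (fderiv ℝ f g)) g :=
    T.hasFDerivAt.comp g hd.hasFDerivAt
  obtain ⟨S, hS, -⟩ := hasFDerivAt_fundDeriv (hf.contDiffAt hg.1) (A : so k m)
  rw [fundDeriv_congr hf.isOpen hg hS.differentiableAt hT.differentiableAt
    (fun h hh => hf.equivariant h hh A) X, fundDeriv, hT.fderiv]
  rfl

lemma IsSection.fundDeriv_gen [FiniteDimensional ℂ W] (hρ : IsIrr ρ) (hf : IsSection ρ O f)
    {g : Mat k m} (hg : g ∈ O ∩ isometries k m) (p q : Idx k m) :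
    fundDeriv (gen p q) (fundDeriv (gen q p) f) g
      = if deg p = deg q then casimirMap ρ (gen q p) (gen p q) (f g)
        else casimirMap ρ (gen p q) (gen q p) (f g) := by
  have hpos : ∀ {r s : Idx k m} (h : deg s < deg r), ρ ⟨gen r s, gen_mem_par h.le⟩ = 0 :=
    fun h => hρ.rep_eq_zero (levi_gen_of_ne h.ne')
  rcases lt_trichotomy (deg p) (deg q) with h | h | h
  -- The inner derivative is along the nilradical, so equivariance makes it vanish on the group.
  · rw [if_neg h.ne, casimirMap_gen_of_lt ρ h, LinearMap.zero_apply]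
    have := hf.fundDeriv_fundDeriv_par hg (gen p q) ⟨gen q p, gen_mem_par h.le⟩
    rw [hpos h, LinearMap.zero_apply, neg_zero] at this
    exact this
  -- Both directions lie in the Levi factor: equivariance is used twice, the signs cancel and the
  -- order is reversed.
  · rw [if_pos h, casimirMap_gen_of_eq ρ h.symm]
    have h1 := hf.fundDeriv_fundDeriv_par hg (gen p q) (levi (gen q p))
    have h2 := hf.equivariant g hg (levi (gen p q))
    rw [levi_gen h] at h2
    rw [levi_gen h.symm, h2, map_neg, neg_neg] at h1
    exact h1
  -- The outer derivative is along the nilradical. Commuting it inside makes that term vanish and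
  -- leaves the derivative along a bracket in the Levi factor, the linear term of `casimirMap`.
  · rw [if_neg h.ne', casimirMap_gen_of_gt ρ h, fundDeriv_comm (hf.contDiffAt hg.1)]
    have h1 := hf.fundDeriv_fundDeriv_par hg (gen q p) ⟨gen p q, gen_mem_par h.le⟩
    rw [hpos h, LinearMap.zero_apply, neg_zero] at h1
    have h2 := hf.equivariant g hg (levi ⁅gen p q, gen q p⁆)
    have h3 : (levi ⁅gen p q, gen q p⁆ : so k m) = ⁅gen p q, gen q p⁆ := by
      rw [lie_gen_gen]
      split_ifs
      · rw [levi_zero]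
        rfl
      · rw [sub_eq_add_neg, ← neg_one_smul ℝ, levi_add, levi_smul]
        change (levi (gen p p)).1 + (-1 : ℝ) • (levi (gen q q)).1 = _
        rw [levi_gen rfl, levi_gen rfl]
    rw [h3] at h2
    rw [h2]
    change fundDeriv (gen q p) (fundDeriv (gen p q) f) g = 0 at h1
    rw [h1, zero_add]
    rfl

lemma IsSection.curvedCasimir_eq [FiniteDimensional ℂ W] (h : 2 * (m : ℝ) + 2 * k - 2 ≠ 0)
    (hρ : IsIrr ρ) (hf : IsSection ρ O f) {d : ℕ} (x : Basis (Fin d) ℝ (so k m)) {g : Mat k m}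
    (hg : g ∈ O ∩ isometries k m) :
    curvedCasimir x f g
      = (kap k m • ∑ p, ∑ q, casimirMap ρ (gen p q) (gen q p)) (f g) := by
  have h1 := sum_killingInv_smul h x (secondDeriv (hf.contDiffAt hg.1))
  refine h1.trans ?_
  simp only [LinearMap.smul_apply, LinearMap.sum_apply]
  rw [← sum_ite_casimirMap]
  congr 1
  exact Finset.sum_congr rfl fun p _ => Finset.sum_congr rfl fun q _ => hf.fundDeriv_gen hρ hg p q

end Derivatives

end KDirac

namespace KDirac

/-! ### The Casimir scalar in terms of highest weights -/

section Brackets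

variable {k m : ℕ}

lemma gen_conj (p q : Idx k m) : gen (conj q) (conj p) = (-1 : ℝ) • gen p q := by
  refine so_ext fun r s => ?_
  change _ = (-1) * (gen p q : Mat k m) r s
  rw [gen_apply, gen_apply, conj_conj, conj_conj]
  ring

lemma levi_gen_conj (p q : Idx k m) : levi (gen (conj q) (conj p)) = -levi (gen p q) := by
  rw [gen_conj, levi_smul, neg_one_smul]

lemma soGen_comm (a b : Fin m ⊕ Fin m) : (soGen b a : par k m) = -soGen a b :=
  levi_gen_conj (.inr (.inl a)) (.inr (.inl b))

lemma soGen_self (a : Fin m ⊕ Fin m) : (soGen a a : par k m) = 0 := by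
  have h : (soGen a a : par k m) + soGen a a = 0 := eq_neg_iff_add_eq_zero.1 (soGen_comm a a)
  rw [← two_smul ℝ] at h
  exact (smul_eq_zero.1 h).resolve_left two_ne_zero

lemma levi_gen_dual (i j : Fin k) :
    levi (gen (.inr (.inr i)) (.inr (.inr j))) = -(glGen j i : par k m) :=
  levi_gen_conj (.inl j) (.inl i)

lemma levi_sub (X Y : so k m) : levi (X - Y) = levi X - levi Y := by
  rw [sub_eq_add_neg, ← neg_one_smul ℝ, levi_add, levi_smul, neg_one_smul, sub_eq_add_neg]

lemma lie_levi_gen {p q : Idx k m} (h : deg p = deg q) (X : so k m) :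
    ⁅levi (gen p q), levi X⁆ = levi ⁅gen p q, X⁆ := by
  rw [← levi_lie_levi, levi_gen h]

lemma lie_glGen {i j : Fin k} :
    ⁅(glGen i j : par k m), (glGen j i : par k m)⁆ = (glGen i i : par k m) - glGen j j := by
  rw [glGen, glGen, lie_levi_gen (by simp [deg]), lie_gen_gen, if_neg (by simp [conj]), levi_sub]
  rfl

lemma lie_soGen {x y z : Fin m ⊕ Fin m} (hxy : x ≠ y) (hxz : x ≠ z) (hyz : y ≠ z) :
    ⁅(soGen x y : par k m), (soGen z y : par k m)⁆ = -(soGen x z : par k m) := by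
  rw [soGen, soGen, lie_levi_gen (by simp [deg]), lie_gen, ← soGen_comm x z, soGen]
  congr 1
  have h1 : ∀ r, (gen (.inr (.inl x)) (.inr (.inl y)) : so k m).1 r (.inr (.inl z)) = 0 := by
    intro r
    rw [gen_apply, if_neg, if_neg, sub_zero]
    · simp [conj, hxz.symm]
    · simp [hyz.symm]
  have h2 : ∀ r, (gen (.inr (.inl x)) (.inr (.inl y)) : so k m).1 (.inr (.inl y)) r =
      if r = .inr (.inl x) then -1 else 0 := by
    intro r
    rw [gen_apply, if_neg (by simp [hxy.symm])]
    simp only [conj, true_and, zero_sub]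
    split_ifs <;> simp
  simp only [h1, h2, zero_smul, Finset.sum_const_zero, ite_smul, Finset.sum_ite_eq',
    Finset.mem_univ, if_true, neg_smul, one_smul, zero_sub, neg_neg]

end Brackets

/-! ### Sums over pairs of indices producing the entries of `δ` -/

section Sums

lemma sum_fin_lt {k : ℕ} (f : Fin k → ℝ) :
    ∑ i, ∑ j, (if i < j then f i else 0) = ∑ i : Fin k, ((k : ℝ) - 1 - (i : ℕ)) * f i := by
  refine Finset.sum_congr rfl fun i _ => ?_
  rw [← Finset.sum_filter, Finset.sum_const, nsmul_eq_mul]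
  congr 1
  have : Finset.univ.filter (fun j => i < j) = Finset.Ioi i := by ext; simp
  rw [this, Fin.card_Ioi]
  have := i.2
  rw [Nat.cast_sub (by omega), Nat.cast_sub (by omega), Nat.cast_one]

lemma sum_fin_gt {k : ℕ} (f : Fin k → ℝ) :
    ∑ i, ∑ j, (if j < i then f i else 0) = ∑ i : Fin k, ((i : ℕ) : ℝ) * f i := by
  refine Finset.sum_congr rfl fun i _ => ?_
  rw [← Finset.sum_filter, Finset.sum_const, nsmul_eq_mul]
  congr 1
  have : Finset.univ.filter (fun j => j < i) = Finset.Iio i := by ext; simp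
  rw [this, Fin.card_Iio]

/-- The contribution of a pair of indices to the Casimir element of `gl(k)`. -/
def glTerm {k : ℕ} (lam : Fin k → ℝ) (i j : Fin k) : ℝ :=
  (if i = j then lam i ^ 2 else 0) + ((if j < i then lam j else 0) - (if j < i then lam i else 0))

lemma sum_glTerm {k : ℕ} (lam : Fin k → ℝ) :
    ∑ i, ∑ j, glTerm lam i j = ∑ i, (lam i ^ 2 + ((k : ℝ) - 1 - 2 * (i : ℕ)) * lam i) := by
  simp only [glTerm, Finset.sum_add_distrib, Finset.sum_sub_distrib, Finset.sum_ite_eq,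
    Finset.mem_univ, if_true]
  rw [sum_fin_gt, Finset.sum_comm, sum_fin_lt, ← Finset.sum_sub_distrib]
  congr 1
  exact Finset.sum_congr rfl fun i _ => by ring

lemma sum_ne_add {k : ℕ} (lam : Fin k → ℝ) :
    ∑ i, ∑ j, (if i = j then 0 else lam i + lam j) = ∑ i, 2 * ((k : ℝ) - 1) * lam i := by
  have h : ∀ i j, (if i = j then 0 else lam i + lam j)
      = lam i + lam j - (if i = j then 2 * lam i else 0) := by
    intro i j
    split_ifs with h
    · rw [h]; ring
    · ring
  simp only [h, Finset.sum_sub_distrib, Finset.sum_add_distrib, Finset.sum_const,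
    Finset.card_univ, Fintype.card_fin, nsmul_eq_mul, Finset.sum_ite_eq, Finset.mem_univ, if_true,
    ← Finset.mul_sum]
  ring

/-- The contribution of a pair of coordinate planes to the Casimir element of `so(n)`. -/
def soTerm {m : ℕ} (sig : Fin m → ℝ) (a b : Fin m) : ℝ :=
  (if a = b then 2 * sig a ^ 2 else 0)
    + ((if a < b then 2 * sig a else 0) + (if b < a then 2 * sig b else 0))

lemma sum_soTerm {m : ℕ} (sig : Fin m → ℝ) :
    ∑ a, ∑ b, soTerm sig a b
      = ∑ a, 2 * (sig a ^ 2 + 2 * ((m : ℝ) - 1 - (a : ℕ)) * sig a) := by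
  simp only [soTerm, Finset.sum_add_distrib, Finset.sum_ite_eq, Finset.mem_univ, if_true]
  rw [sum_fin_lt fun a => 2 * sig a,
    Finset.sum_comm (f := fun a b => if b < a then 2 * sig b else 0),
    sum_fin_lt fun a => 2 * sig a, ← Finset.sum_add_distrib, ← Finset.sum_add_distrib]
  exact Finset.sum_congr rfl fun a _ => by ring

end Sums

/-! ### Evaluation on a highest weight vector -/

section Weights

variable {k m : ℕ} {V : Type*} [AddCommGroup V] [Module ℂ V] {τ : PRep k m V}
  {lam : Fin k → ℝ} {sig : Fin m → ℝ} {v : V}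

/-- When `j < i` the inner factor lowers; commuting it past the raising operator, which kills `v`,
leaves a difference of weights. -/
lemma IsHighestWeightVector.gl_gl (hv : IsHighestWeightVector τ lam sig v) (i j : Fin k) :
    τ (glGen j i) (τ (glGen i j) v) = (glTerm lam i j : ℂ) • v := by
  rcases lt_trichotomy i j with h | h | h
  · rw [hv.gl_raise i j h, map_zero, glTerm, if_neg h.ne, if_neg h.not_gt, if_neg h.not_gt]
    simp
  · subst h
    rw [hv.gl_weight, map_smul, hv.gl_weight, smul_smul, glTerm]
    simp [sq]
  · have e := rep_lie_apply τ (glGen j i) (glGen i j) v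
    rw [hv.gl_raise j i h, map_zero, sub_zero, lie_glGen, map_sub, LinearMap.sub_apply,
      hv.gl_weight, hv.gl_weight] at e
    rw [← e, glTerm, if_neg h.ne', if_pos h, if_pos h, ← sub_smul]
    simp

lemma IsHighestWeightVector.so_rot (hv : IsHighestWeightVector τ lam sig v) (a : Fin m) :
    τ (soGen (.inl a) (.inr a)) v = (Complex.I * sig a) • v := by
  rw [mul_smul, ← hv.so_weight, smul_smul, mul_neg, Complex.I_mul_I, neg_neg, one_smul]

/-- The sum of the squares of the four generators rotating the `a`-th coordinate plane into the
`b`-th one. -/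
noncomputable def planeSq (τ : PRep k m V) (v : V) (a b : Fin m) : V :=
  τ (soGen (.inl a) (.inl b)) (τ (soGen (.inl a) (.inl b)) v)
    + τ (soGen (.inl a) (.inr b)) (τ (soGen (.inl a) (.inr b)) v)
    + τ (soGen (.inr a) (.inl b)) (τ (soGen (.inr a) (.inl b)) v)
    + τ (soGen (.inr a) (.inr b)) (τ (soGen (.inr a) (.inr b)) v)

lemma planeSq_comm (a b : Fin m) : planeSq τ v b a = planeSq τ v a b := by
  simp only [planeSq, soGen_comm (.inl a) (.inl b), soGen_comm (.inr a) (.inl b),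
    soGen_comm (.inl a) (.inr b), soGen_comm (.inr a) (.inr b), map_neg, LinearMap.neg_apply,
    neg_neg]
  abel

lemma IsHighestWeightVector.planeSq_of_lt (hv : IsHighestWeightVector τ lam sig v) {a b : Fin m}
    (h : a < b) : -planeSq τ v a b = ((2 * sig a : ℝ) : ℂ) • v := by
  have hne : a ≠ b := h.ne
  have c13 := rep_lie_apply τ (soGen (.inl a) (.inl b)) (soGen (.inr a) (.inl b)) v
  rw [lie_soGen (by simpa using hne) (by simp) (by simp), map_neg, LinearMap.neg_apply,
    hv.so_rot] at c13
  have c42 := rep_lie_apply τ (soGen (.inr a) (.inr b)) (soGen (.inl a) (.inr b)) v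
  rw [lie_soGen (by simpa using hne) (by simp) (by simp), soGen_comm (.inl a) (.inr a), neg_neg,
    hv.so_rot] at c42
  have e1 := hv.so_raise_add a b h
  have e2 := hv.so_raise_sub a b h
  rw [planeSq]
  generalize τ (soGen (.inl a) (.inl b)) = s1 at *
  generalize τ (soGen (.inl a) (.inr b)) = s2 at *
  generalize τ (soGen (.inr a) (.inl b)) = s3 at *
  generalize τ (soGen (.inr a) (.inr b)) = s4 at *
  -- The two raising operators for `ε_a + ε_b` and `ε_a - ε_b` are multiplied on the left by the
  -- corresponding lowering operators. Adding the products gives twice the sum of the four squares,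
  -- plus commutators that are rotations of the `a`-th plane and act on `v` through `sig a`.
  have f1 := congrArg (s1 - Complex.I • s2 - Complex.I • s3 - s4) e1
  have f2 := congrArg (s1 + Complex.I • s2 - Complex.I • s3 + s4) e2
  simp only [LinearMap.add_apply, LinearMap.sub_apply, LinearMap.smul_apply, map_add, map_sub,
    map_smul, map_zero, smul_add, smul_sub, smul_smul, Complex.I_mul_I] at f1 f2
  have c13' := congrArg (fun w => Complex.I • w) c13
  have c42' := congrArg (fun w => Complex.I • w) c42
  simp only [smul_sub, smul_neg, smul_smul, ← mul_assoc, Complex.I_mul_I] at c13' c42'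
  push_cast
  linear_combination (norm := module) (-1 / 2 : ℂ) • f1 + (-1 / 2 : ℂ) • f2 - c13' + c42'

lemma IsHighestWeightVector.planeSq_self (hv : IsHighestWeightVector τ lam sig v) (a : Fin m) :
    -planeSq τ v a a = ((2 * sig a ^ 2 : ℝ) : ℂ) • v := by
  have e : τ (soGen (.inl a) (.inr a)) (τ (soGen (.inl a) (.inr a)) v)
      = -((sig a : ℂ) ^ 2 • v) := by
    rw [hv.so_rot, map_smul, hv.so_rot, smul_smul, ← neg_smul]
    congr 1
    linear_combination (sig a : ℂ) ^ 2 * Complex.I_mul_I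
  simp only [planeSq, soGen_self, soGen_comm (.inl a) (.inr a), map_neg, map_zero,
    LinearMap.neg_apply, LinearMap.zero_apply, neg_neg, e]
  push_cast
  module

lemma IsHighestWeightVector.neg_planeSq (hv : IsHighestWeightVector τ lam sig v) (a b : Fin m) :
    -planeSq τ v a b = (soTerm sig a b : ℂ) • v := by
  rcases lt_trichotomy a b with h | h | h
  · rw [hv.planeSq_of_lt h, soTerm, if_neg h.ne, if_pos h, if_neg h.not_gt, zero_add, add_zero]
  · subst h
    rw [hv.planeSq_self, soTerm]
    simp
  · rw [← planeSq_comm, hv.planeSq_of_lt h, soTerm, if_neg h.ne', if_pos h, if_neg h.not_gt,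
      zero_add, zero_add]

/-- The transpose of `casimirMap`, in terms of the dual representation. -/
noncomputable def dualTerm (τ : PRep k m V) (v : V) (p q : Idx k m) : V :=
  τ (levi (gen q p)) (τ (levi (gen p q)) v)
    + τ (levi ⁅part (fun e => 0 < e) (gen p q), part (fun e => e < 0) (gen q p)⁆) v

lemma dualTerm_of_le {p q : Idx k m} (h : deg p ≤ deg q) :
    dualTerm τ v p q = τ (levi (gen q p)) (τ (levi (gen p q)) v) := by
  rw [dualTerm, part_gen, if_neg (by omega), zero_lie, levi_zero, map_zero, LinearMap.zero_apply,
    add_zero]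

lemma dualTerm_of_lt {p q : Idx k m} (h : deg p < deg q) : dualTerm τ v p q = 0 := by
  rw [dualTerm_of_le h.le, levi_gen_of_ne h.ne, map_zero, LinearMap.zero_apply, map_zero]

lemma dualTerm_of_gt {p q : Idx k m} (h : deg q < deg p) :
    dualTerm τ v p q = if q = conj p then 0 else τ (levi (gen p p)) v - τ (levi (gen q q)) v := by
  rw [dualTerm, part_gen, if_pos (by omega), part_gen, if_pos (by omega), levi_gen_of_ne h.ne',
    map_zero, LinearMap.zero_apply, map_zero, zero_add, lie_gen_gen]
  split_ifs
  · rw [levi_zero, map_zero, LinearMap.zero_apply]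
  · rw [levi_sub, map_sub, LinearMap.sub_apply]

lemma sum_smul_real {ι : Type*} [Fintype ι] (f : ι → ι → ℝ) (v : V) :
    ∑ i, ∑ j, (f i j : ℂ) • v = ((∑ i, ∑ j, f i j : ℝ) : ℂ) • v := by
  simp only [← Finset.sum_smul, Complex.ofReal_sum]

/-- The quadratic terms come from the diagonal blocks. The linear ones assemble into `2 δ`: the
blocks of positive degree and the ordering of `gl(k)` give the first `k` entries, the ordering of
`so(n)` the others. The overall 2 is the overcounting of generators. -/
lemma IsHighestWeightVector.sum_dualTerm (hv : IsHighestWeightVector τ lam sig v) :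
    ∑ p, ∑ q, dualTerm τ v p q
      = ((2 * ∑ p, ((Sum.elim lam sig p + delta k m p) ^ 2 - delta k m p ^ 2) : ℝ) : ℂ) • v := by
  have gl (i : Fin k) : τ (levi (gen (.inl i) (.inl i))) v = (lam i : ℂ) • v := hv.gl_weight i
  have gl' (i : Fin k) : τ (levi (gen (.inr (.inr i)) (.inr (.inr i)))) v = -((lam i : ℂ) • v) := by
    rw [levi_gen_dual, map_neg, LinearMap.neg_apply, hv.gl_weight]
  have so0 (a : Fin m ⊕ Fin m) : τ (levi (gen (.inr (.inl a)) (.inr (.inl a)))) v = 0 := by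
    rw [show levi (gen (.inr (.inl a)) (.inr (.inl a))) = (soGen a a : par k m) from rfl,
      soGen_self, map_zero, LinearMap.zero_apply]
  have t11 (i j : Fin k) : dualTerm τ v (.inl i) (.inl j) = (glTerm lam i j : ℂ) • v := by
    rw [dualTerm_of_le (by simp [deg])]
    exact hv.gl_gl i j
  have t33 (i j : Fin k) : dualTerm τ v (.inr (.inr i)) (.inr (.inr j))
      = (glTerm lam j i : ℂ) • v := by
    rw [dualTerm_of_le (by simp [deg]), levi_gen_dual, levi_gen_dual]
    simp only [map_neg, LinearMap.neg_apply, neg_neg]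
    exact hv.gl_gl j i
  have t12 (i : Fin k) (a : Fin m ⊕ Fin m) : dualTerm τ v (.inl i) (.inr (.inl a))
      = (lam i : ℂ) • v := by
    rw [dualTerm_of_gt (by simp [deg]), if_neg (by simp [conj]), gl, so0, sub_zero]
  have t23 (i : Fin k) (a : Fin m ⊕ Fin m) : dualTerm τ v (.inr (.inl a)) (.inr (.inr i))
      = (lam i : ℂ) • v := by
    rw [dualTerm_of_gt (by simp [deg]), if_neg (by simp [conj]), gl', so0, zero_sub, neg_neg]
  have t13 (i j : Fin k) : dualTerm τ v (.inl i) (.inr (.inr j))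
      = ((if i = j then 0 else lam i + lam j : ℝ) : ℂ) • v := by
    rw [dualTerm_of_gt (by simp [deg]), gl, gl', sub_neg_eq_add, ← add_smul]
    by_cases h : i = j
    · simp [h, conj]
    · rw [if_neg (by simpa [conj] using Ne.symm h), if_neg h]
      push_cast
      rfl
  have t21 (i : Fin k) (a : Fin m ⊕ Fin m) : dualTerm τ v (.inr (.inl a)) (.inl i) = 0 :=
    dualTerm_of_lt (by simp [deg])
  have t31 (i j : Fin k) : dualTerm τ v (.inr (.inr i)) (.inl j) = 0 :=
    dualTerm_of_lt (by simp [deg])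
  have t32 (i : Fin k) (a : Fin m ⊕ Fin m) : dualTerm τ v (.inr (.inr i)) (.inr (.inl a)) = 0 :=
    dualTerm_of_lt (by simp [deg])
  have t22 (a b : Fin m ⊕ Fin m) : dualTerm τ v (.inr (.inl a)) (.inr (.inl b))
      = -τ (soGen a b) (τ (soGen a b) v) := by
    rw [dualTerm_of_le (by simp [deg])]
    change τ (soGen b a) (τ (soGen a b) v) = _
    rw [soGen_comm, map_neg, LinearMap.neg_apply]
  have m22 : ∑ a, ∑ b, -τ (soGen a b) (τ (soGen a b) v)
      = ((∑ a, ∑ b, soTerm sig a b : ℝ) : ℂ) • v := by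
    rw [← sum_smul_real]
    simp only [← hv.neg_planeSq, planeSq, Fintype.sum_sum_type, neg_add, Finset.sum_add_distrib]
    abel
  have s11 : ∑ i, ∑ j, dualTerm τ v (.inl i) (.inl j)
      = ((∑ i, ∑ j, glTerm lam i j : ℝ) : ℂ) • v := by
    simp only [t11, sum_smul_real]
  have s33 : ∑ i, ∑ j, dualTerm τ v (.inr (.inr i)) (.inr (.inr j))
      = ((∑ i, ∑ j, glTerm lam i j : ℝ) : ℂ) • v := by
    rw [Finset.sum_comm]
    simp only [t33, sum_smul_real]
  have s12 : ∑ i, ∑ a, dualTerm τ v (.inl i) (.inr (.inl a))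
      = ((∑ i, 2 * m * lam i : ℝ) : ℂ) • v := by
    simp only [t12, Finset.sum_const, Finset.card_univ, Fintype.card_sum, Fintype.card_fin,
      ← Nat.cast_smul_eq_nsmul ℂ, smul_smul, ← Finset.sum_smul]
    push_cast
    congr 1
    exact Finset.sum_congr rfl fun i _ => by ring
  have s23 : ∑ a, ∑ i, dualTerm τ v (.inr (.inl a)) (.inr (.inr i))
      = ((∑ i, 2 * m * lam i : ℝ) : ℂ) • v := by
    rw [← s12, Finset.sum_comm]
    simp only [t12, t23]
  have s13 : ∑ i, ∑ j, dualTerm τ v (.inl i) (.inr (.inr j))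
      = ((∑ i, 2 * ((k : ℝ) - 1) * lam i : ℝ) : ℂ) • v := by
    simp only [t13, sum_smul_real, sum_ne_add]
  have s22 : ∑ a, ∑ b, dualTerm τ v (.inr (.inl a)) (.inr (.inl b))
      = ((∑ a, ∑ b, soTerm sig a b : ℝ) : ℂ) • v := by
    rw [← m22]
    simp only [t22]
  have split (F : Idx k m → Idx k m → V) : ∑ p, ∑ q, F p q =
      (∑ i, ∑ j, F (.inl i) (.inl j) + (∑ i, ∑ a, F (.inl i) (.inr (.inl a))
        + ∑ i, ∑ j, F (.inl i) (.inr (.inr j))))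
      + ((∑ a, ∑ j, F (.inr (.inl a)) (.inl j) + (∑ a, ∑ b, F (.inr (.inl a)) (.inr (.inl b))
        + ∑ a, ∑ j, F (.inr (.inl a)) (.inr (.inr j))))
      + (∑ i, ∑ j, F (.inr (.inr i)) (.inl j) + (∑ i, ∑ a, F (.inr (.inr i)) (.inr (.inl a))
        + ∑ i, ∑ j, F (.inr (.inr i)) (.inr (.inr j))))) := by
    rw [Fintype.sum_sum_type, Fintype.sum_sum_type (f := fun q => ∑ r, F (.inr q) r)]
    simp only [Fintype.sum_sum_type (α₁ := Fin k) (α₂ := (Fin m ⊕ Fin m) ⊕ Fin k),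
      Fintype.sum_sum_type (α₁ := Fin m ⊕ Fin m) (α₂ := Fin k), Finset.sum_add_distrib]
  rw [split, s11, s12, s13, s22, s23, s33]
  simp only [t21, t31, t32, Finset.sum_const_zero, zero_add]
  simp only [← add_smul, ← Complex.ofReal_add]
  congr 2
  rw [sum_glTerm, sum_soTerm, Fintype.sum_sum_type]
  simp only [Sum.elim_inl, Sum.elim_inr, delta, Finset.mul_sum, mul_add,
    ← Finset.sum_add_distrib]
  have r1 : ∑ i, 2 * ((lam i + (k + m - 1 - (i : ℕ) : ℝ)) ^ 2 - (k + m - 1 - (i : ℕ) : ℝ) ^ 2)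
      = ∑ i, (lam i ^ 2 + ((k : ℝ) - 1 - 2 * (i : ℕ)) * lam i)
        + ∑ i, 2 * m * lam i + ∑ i, 2 * ((k : ℝ) - 1) * lam i + ∑ i, 2 * m * lam i
        + ∑ i, (lam i ^ 2 + ((k : ℝ) - 1 - 2 * (i : ℕ)) * lam i) := by
    simp only [← Finset.sum_add_distrib]
    exact Finset.sum_congr rfl fun i _ => by ring
  have r2 : ∑ a, 2 * ((sig a + (m - 1 - (a : ℕ) : ℝ)) ^ 2 - (m - 1 - (a : ℕ) : ℝ) ^ 2)
      = ∑ a, (2 * sig a ^ 2 + 2 * (2 * ((m : ℝ) - 1 - (a : ℕ)) * sig a)) :=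
    Finset.sum_congr rfl fun a _ => by ring
  rw [r1, r2]
  simp only [Finset.sum_add_distrib]
  ring

end Weights

/-! ### The scalar from the highest weight of the dual -/

section Dual

variable {k m : ℕ} {W : Type*} [AddCommGroup W] [Module ℂ W] {ρ : PRep k m W}

lemma dualRep_apply (A : par k m) (φ : Dual ℂ W) : dualRep ρ A φ = -(φ ∘ₗ ρ A) := rfl

/-- Transposition reverses the products. The signs of the dual action cancel in the quadratic term
but turn the minus before the bracket into a plus. -/
lemma comp_casimirMap (φ : Dual ℂ W) (p q : Idx k m) :
    φ ∘ₗ casimirMap ρ (gen p q) (gen q p) = dualTerm (dualRep ρ) φ p q := by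
  ext w
  simp [casimirMap_apply, dualTerm, dualRep_apply, sub_eq_add_neg]

lemma smul_eq_of_dual_highestWeight {mu : Fin k → ℝ} {sig : Fin m → ℝ}
    (h : HasHighestWeight (dualRep ρ) mu sig) {c : ℂ}
    (hc : kap k m • ∑ p, ∑ q, casimirMap ρ (gen p q) (gen q p) = c • 1) :
    c = ((kap k m * (2 * ∑ p, ((Sum.elim mu sig p + delta k m p) ^ 2 - delta k m p ^ 2)) : ℝ) : ℂ)
      := by
  obtain ⟨φ, hφ⟩ := h
  have e : c • φ = kap k m • ∑ p, ∑ q, dualTerm (dualRep ρ) φ p q := by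
    simp only [← comp_casimirMap]
    have h1 : c • φ = φ ∘ₗ (c • (1 : Module.End ℂ W)) := by
      ext w
      simp
    rw [h1, ← hc]
    ext w
    simp [LinearMap.sum_apply]
  rw [hφ.sum_dualTerm, ← Complex.coe_smul, smul_smul, ← Complex.ofReal_mul] at e
  exact smul_left_injective ℂ hφ.ne_zero e

/-- Signed permutations preserve the Euclidean norm. -/
lemma sum_sq_of_mem_affineOrbit {μ μ' : Fin k ⊕ Fin m → ℝ} (h : μ' ∈ affineOrbit μ) :
    ∑ p, (μ' p + delta k m p) ^ 2 = ∑ p, (μ p + delta k m p) ^ 2 := by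
  obtain ⟨τ, s, -, hs⟩ := h
  rw [← Equiv.sum_comp τ fun p => (μ p + delta k m p) ^ 2]
  refine Finset.sum_congr rfl fun p _ => ?_
  rw [hs]
  rcases Int.units_eq_one_or (s p) with h | h <;> rw [h] <;> push_cast <;> ring

lemma sum_sq_baseWeight (t : ℤˣ) :
    ∑ p, (baseWeight k m t p + delta k m p) ^ 2 = ∑ p, (baseWeight k m 1 p + delta k m p) ^ 2 := by
  refine Finset.sum_congr rfl fun p _ => ?_
  rcases p with i | a
  · rfl
  · simp only [baseWeight, delta, Sum.elim_inr, spinWeight]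
    split_ifs with h
    · have : (m : ℝ) - 1 - (a : ℕ) = 0 := by
        have : ((a : ℕ) : ℝ) + 1 = m := by exact_mod_cast h
        linarith
      rw [this]
      rcases Int.units_eq_one_or t with h | h <;> norm_num [h]
    · rfl

/-- The right-hand side depends only on `k` and `m`, not on the module; this already gives the
equality of the eigenvalues. -/
lemma DualOnOrbits.eq {c : ℂ} (h : DualOnOrbits ρ)
    (hc : kap k m • ∑ p, ∑ q, casimirMap ρ (gen p q) (gen q p) = c • 1) :
    c = ((kap k m * (2 * (∑ p, (baseWeight k m 1 p + delta k m p) ^ 2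
      - ∑ p, delta k m p ^ 2)) : ℝ) : ℂ) := by
  obtain ⟨mu, sig, hw, ho⟩ := h
  rw [smul_eq_of_dual_highestWeight hw hc, Finset.sum_sub_distrib]
  rcases ho with ho | ho
  · rw [sum_sq_of_mem_affineOrbit ho]
  · rw [sum_sq_of_mem_affineOrbit ho, sum_sq_baseWeight]

end Dual

/-! ### Existence and uniqueness of the Casimir eigenvalue -/

section Eigenvalue

variable {k m : ℕ} {W : Type*} [NormedAddCommGroup W] [NormedSpace ℂ W] [FiniteDimensional ℂ W]
  {ρ : PRep k m W}

lemma IsIrr.isCasimirEigenvalue_iff (h : 2 * (m : ℝ) + 2 * k - 2 ≠ 0) (hρ : IsIrr ρ) {c : ℂ}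
    (hc : kap k m • ∑ p, ∑ q, casimirMap ρ (gen p q) (gen q p) = c • 1) (z : ℂ) :
    IsCasimirEigenvalue ρ z ↔ z = c := by
  have := hρ.1
  constructor
  · intro hz
    have e := hz.algebraic _ (Module.finBasis ℝ (so k m))
    rw [algCasimir_eq h, hc] at e
    exact (smul_left_injective ℂ one_ne_zero e).symm
  · rintro rfl
    refine ⟨fun d x => by rw [algCasimir_eq h, hc], fun d x O f hf g hg => ?_⟩
    rw [hf.curvedCasimir_eq h hρ x hg, hc]
    rfl

end Eigenvalue

end KDirac

theorem mainTheorem2 (n k m : ℕ) (hn : n = 2 * m) (hk : 4 ≤ 2 * k) (hkn : 2 * k ≤ n)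
    {W₁ W₂ : Type*}
    [NormedAddCommGroup W₁] [NormedSpace ℂ W₁] [FiniteDimensional ℂ W₁]
    [NormedAddCommGroup W₂] [NormedSpace ℂ W₂] [FiniteDimensional ℂ W₂]
    (ρ₁ : KDirac.PRep k m W₁) (ρ₂ : KDirac.PRep k m W₂)
    (lam nu : Fin k → ℝ) (s₁ s₂ : ℤˣ)
    (h₁ : KDirac.IsSpinorModule ρ₁ lam s₁) (h₂ : KDirac.IsSpinorModule ρ₂ nu s₂)
    (hd₁ : KDirac.DualOnOrbits ρ₁) (hd₂ : KDirac.DualOnOrbits ρ₂)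
    (i j : Fin k) (hij : i < j) (hnu : nu = KDirac.raise lam i j) :
    ∃ c_lam c_nu : ℂ,
      (∀ z, KDirac.IsCasimirEigenvalue ρ₁ z ↔ z = c_lam) ∧
      (∀ z, KDirac.IsCasimirEigenvalue ρ₂ z ↔ z = c_nu) ∧
      c_lam - c_nu = 0 := by
  -- This factor relates the Killing form to the trace form; it must be nonzero for the Killing form
  -- to be invertible.
  have h : 2 * (m : ℝ) + 2 * k - 2 ≠ 0 := by
    have : (2 : ℝ) ≤ k := by exact_mod_cast (by omega : 2 ≤ k)
    have : (0 : ℝ) ≤ m := m.cast_nonneg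
    linarith
  obtain ⟨c₁, hc₁⟩ := h₁.1.exists_algCasimir_eq
  obtain ⟨c₂, hc₂⟩ := h₂.1.exists_algCasimir_eq
  exact ⟨c₁, c₂, h₁.1.isCasimirEigenvalue_iff h hc₁, h₂.1.isCasimirEigenvalue_iff h hc₂,
    by rw [hd₁.eq hc₁, hd₂.eq hc₂, sub_self]⟩
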